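/- Let $(y_j)_{j\in\mathbb Z}$ be variables, either all independent, or with $y_{j+2n}=y_j$ for all $j$ and $y_1,\dots,y_{2n}$ independent, for some $n\ge 1$. We work in the field of rational functions over $\mathbb Q$ in these variables. Define $F_{j,k}$ for $j\in\mathbb Z$, $k\ge -1$, by $F_{j,-1}=F_{j,0}=1$ and $$F_{j,k+1}=\frac{F_{j-3,k}F_{j+3,k}+\left(\prod_{i=-k}^{k}y_{j+3i}\right)F_{j-1,k}F_{j+1,k}}{F_{j,k-1}}\qquad(k\ge 0).$$ For integers $i,j$ let $$m_{i,j,0}=\prod_{l=0}^{j-1}\prod_{m=0}^{l}y_{3i+j-4l+6m-1},$$ with the convention $\prod_{i=a}^{a-1}z_i=1$ and $\prod_{i=a}^{b}z_i=\prod_{i=b+1}^{a-1}z_i^{-1}$ for $b<a-1$. For $k\ge 0$ let $X_k$ be the $k\times k$ matrix whose $(a,b)$ entry is $m_{-k-1+a+b,\;b-a,\;0}$ ($1\le a,b\le k$). For matrices $X$ and $A$ of the same size, where $A$ has integer entries, put $X^A=\prod_{i,j}x_{ij}^{a_{ij}}$. Let $ASM(k)$ be the set of $k\times k$ alternating sign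 matrices, i.e. matrices with entries in $\{1,0,-1\}$ whose non-zero entries alternate in sign along each row and column and whose row and column sums are all $1$. Let $Q_k$ be the set of $(r,s,t)\in\mathbb Z^3$ with $2|s|-(k-2)\le t\le k-2-2|r|$ and $2|s|-(k-2)\equiv t\equiv k-2-2|r| \pmod 4$, and let $P_k=Q_{k+1}\cup Q_k$, partially ordered so that $(r',s',t')$ covers $(r,s,t)$ if and only if $t'=t+1$ and $|r'-r|+|s'-s|=1$; $Q_k$ carries the restricted order. An order ideal is a downward closed subset. To an order ideal $I$ of $Q_k$ associate $$H(r,s)=\begin{cases}k+2+\max\{t:(r,s,t)\in I\},&\text{if such a } t \text{ exists}\\ 2|s|,&\text{otherwise,}\end{cases}$$ $a^*_{ij}=\frac12H(-k+i+j,-i+j)$ for $0\le i,j\le k$, and the $k\times k$ matrix $A$ with entries $a_{ij}=\frac12(a^*_{i-1,j}+a^*_{i,j-1}-a^*_{i-1,j-1}-a^*_{i,j})$, $1\le i,j\le k$. Call $A\in ASM(k+1)$ and $B\in ASM(k)$ compatible if they correspond in this way to order ideals $I$ of $Q_{k+1}$ and $J$ of $Q_k$ such that $I\cup J$ is an order ideal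 of $P_k$. Then for every $k\ge 0$, $$F_{0,k}=\sum_{A,B}(X_{k+1})^A(X_k)^B,$$ where the sum is over all compatible pairs $A\in ASM(k+1)$, $B\in ASM(k)$. -/

import Mathlib

namespace PentagramASM

/-! ### Products with arbitrary integer bounds and the monomials `m_{i,j,0}` -/

/-- The product `∏_{i=a}^{b} z_i` for arbitrary integers `a`, `b`: it is `1` for `b = a - 1`, and
`∏_{i=b+1}^{a-1} 1 / z_i` for `b < a - 1`. -/
noncomputable def intProd {K : Type*} [Field K] (a b : ℤ) (z : ℤ → K) : K :=
  if a ≤ b + 1 then ∏ i ∈ Finset.Icc a b, z i else ∏ i ∈ Finset.Icc (b + 1) (a - 1), (z i)⁻¹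

/-- The Laurent monomial `m_{i,j,0} = ∏_{l=0}^{j-1} ∏_{m=0}^{l} y_{3i+j-4l+6m-1}`. -/
noncomputable def mZero {K : Type*} [Field K] (y : ℤ → K) (i j : ℤ) : K :=
  intProd 0 (j - 1) fun l => intProd 0 l fun m => y (3 * i + j - 4 * l + 6 * m - 1)

/-- The `k × k` matrix `X_k`. With rows and columns numbered from `0`, its `(a, b)` entry is
`m_{-(k-1)+a+b, b-a, 0}`: the first row is `m_{-(k-1),0,0}, m_{-(k-1)+1,1,0}, …, m_{0,k-1,0}` and
the last row is `m_{0,-(k-1),0}, …, m_{k-1,0,0}`. -/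
noncomputable def X {K : Type*} [Field K] (y : ℤ → K) (k : ℕ) : Matrix (Fin k) (Fin k) K :=
  Matrix.of fun a b =>
    mZero y (-((k : ℤ) - 1) + ((a : ℕ) : ℤ) + ((b : ℕ) : ℤ)) (((b : ℕ) : ℤ) - ((a : ℕ) : ℤ))

/-- `X^A = ∏_i ∏_j x_{ij}^{a_{ij}}`, where the exponents may be negative. -/
def matPow {K : Type*} [Field K] {k : ℕ} (x : Matrix (Fin k) (Fin k) K)
    (A : Matrix (Fin k) (Fin k) ℤ) : K :=
  ∏ i, ∏ j, x i j ^ A i j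

/-! ### The `F`-polynomials -/

/-- `Faux y n j` is `F_{j,n-1}`; thus `F_{j,-1} = F_{j,0} = 1`, and the last clause is
`F_{j,n+1} = (F_{j-3,n} F_{j+3,n} + (∏_{i=-n}^{n} y_{j+3i}) F_{j-1,n} F_{j+1,n}) / F_{j,n-1}`. -/
noncomputable def Faux {K : Type*} [Field K] (y : ℤ → K) : ℕ → ℤ → K
  | 0, _ => 1
  | 1, _ => 1
  | n + 2, j =>
    (Faux y (n + 1) (j - 3) * Faux y (n + 1) (j + 3) +
      (∏ i ∈ Finset.Icc (-(n : ℤ)) (n : ℤ), y (j + 3 * i)) *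
        (Faux y (n + 1) (j - 1) * Faux y (n + 1) (j + 1))) / Faux y n j

/-- `F_{j,k}` for `k ≥ 0`. -/
noncomputable def F {K : Type*} [Field K] (y : ℤ → K) (j : ℤ) (k : ℕ) : K := Faux y (k + 1) j

/-- The field of rational functions over `ℚ` in independent variables indexed by `ℤ/2nℤ`.
For `n = 0` this index set is `ℤ` itself. -/
abbrev RatFun (n : ℕ) : Type := FractionRing (MvPolynomial (ZMod (2 * n)) ℚ)

/-- The variables `y_j`, `j ∈ ℤ`. For `n ≥ 1`, the variables `y_1, …, y_{2n}` are independent and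
`y_{j+2n} = y_j`; for `n = 0`, all the variables `y_j`, `j ∈ ℤ`, are independent. -/
noncomputable def yVar (n : ℕ) (j : ℤ) : RatFun n :=
  algebraMap (MvPolynomial (ZMod (2 * n)) ℚ) (RatFun n) (MvPolynomial.X (j : ZMod (2 * n)))

/-! ### The posets `Q_k` and `P_k` and their order ideals -/

/-- The set `Q_k` of triples `(r, s, t)` of integers. -/
def Q (k : ℕ) : Set (ℤ × ℤ × ℤ) :=
  {p | 2 * |p.2.1| - ((k : ℤ) - 2) ≤ p.2.2 ∧ p.2.2 ≤ (k : ℤ) - 2 - 2 * |p.1| ∧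
    2 * |p.2.1| - ((k : ℤ) - 2) ≡ p.2.2 [ZMOD 4] ∧ p.2.2 ≡ (k : ℤ) - 2 - 2 * |p.1| [ZMOD 4]}

/-- `P_k = Q_{k+1} ∪ Q_k`. -/
def P (k : ℕ) : Set (ℤ × ℤ × ℤ) := Q (k + 1) ∪ Q k

/-- `CoverP k p q`: the element `q` of `P_k` covers the element `p` of `P_k`. -/
def CoverP (k : ℕ) (p q : ℤ × ℤ × ℤ) : Prop :=
  p ∈ P k ∧ q ∈ P k ∧ q.2.2 = p.2.2 + 1 ∧ |q.1 - p.1| + |q.2.1 - p.2.1| = 1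

/-- The partial order of `P_k`, generated by its covering relation. -/
def LeP (k : ℕ) (p q : ℤ × ℤ × ℤ) : Prop := Relation.ReflTransGen (CoverP k) p q

/-- Order ideals of `P_k`. -/
def IsIdealP (k : ℕ) (I : Set (ℤ × ℤ × ℤ)) : Prop :=
  I ⊆ P k ∧ ∀ x ∈ I, ∀ y ∈ P k, LeP k y x → y ∈ I

/-- Order ideals of `Q_k`, whose order is the restriction of the order of `P_k`. -/
def IsIdealQ (k : ℕ) (I : Set (ℤ × ℤ × ℤ)) : Prop :=
  I ⊆ Q k ∧ ∀ x ∈ I, ∀ y ∈ Q k, LeP k y x → y ∈ I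

/-! ### Alternating sign matrices -/

/-- Alternating sign matrices: the entries are `1`, `0`, `-1`, two successive nonzero entries of a
row or of a column have opposite signs, and all row sums and column sums are `1`. -/
def IsASM {k : ℕ} (A : Matrix (Fin k) (Fin k) ℤ) : Prop :=
  (∀ i j, A i j = 1 ∨ A i j = 0 ∨ A i j = -1) ∧
  (∀ i j j', j < j' → A i j ≠ 0 → A i j' ≠ 0 → (∀ l, j < l → l < j' → A i l = 0) →
    A i j' = -A i j) ∧
  (∀ j i i', i < i' → A i j ≠ 0 → A i' j ≠ 0 → (∀ l, i < l → l < i' → A l j = 0) →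
    A i' j = -A i j) ∧
  (∀ i, ∑ j, A i j = 1) ∧ (∀ j, ∑ i, A i j = 1)

open scoped Classical in
/-- The height function of an order ideal `I` of `Q_k`:
`H(r, s) = k + 2 + max {t : (r, s, t) ∈ I}` if there is such a `t`, and `2|s|` otherwise. -/
noncomputable def height (k : ℕ) (I : Set (ℤ × ℤ × ℤ)) (r s : ℤ) : ℤ :=
  if ∃ t, (r, s, t) ∈ I then (k : ℤ) + 2 + sSup {t | (r, s, t) ∈ I} else 2 * |s|

/-- `a*_{ij} = H(-k+i+j, -i+j) / 2`, for `0 ≤ i, j ≤ k`. -/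
noncomputable def aStar (k : ℕ) (I : Set (ℤ × ℤ × ℤ)) (i j : ℕ) : ℚ :=
  (height k I (-(k : ℤ) + i + j) (-(i : ℤ) + j) : ℚ) / 2

/-- The matrix `A` corresponds to the order ideal `I` of `Q_k`: with rows and columns numbered from
`1`, `a_{ij} = (a*_{i-1,j} + a*_{i,j-1} - a*_{i-1,j-1} - a*_{i,j}) / 2`. Here the indices in
`Fin k` start from `0`, while those of `a*` are unchanged. -/
def Corresponds {k : ℕ} (I : Set (ℤ × ℤ × ℤ)) (A : Matrix (Fin k) (Fin k) ℤ) : Prop :=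
  ∀ i j : Fin k, (A i j : ℚ) =
    (aStar k I i (j + 1) + aStar k I (i + 1) j - aStar k I i j - aStar k I (i + 1) (j + 1)) / 2

/-- `A ∈ ASM(k+1)` and `B ∈ ASM(k)` are compatible if the order ideals `I` of `Q_{k+1}` and `J` of
`Q_k` that correspond to them are such that `I ∪ J` is an order ideal of `P_k`. -/
def Compatible {k : ℕ} (A : Matrix (Fin (k + 1)) (Fin (k + 1)) ℤ)
    (B : Matrix (Fin k) (Fin k) ℤ) : Prop :=
  ∃ I J : Set (ℤ × ℤ × ℤ), IsIdealQ (k + 1) I ∧ IsIdealQ k J ∧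
    Corresponds I A ∧ Corresponds J B ∧ IsIdealP k (I ∪ J)

/-- The set of all compatible pairs `(A, B)` with `A ∈ ASM(k+1)` and `B ∈ ASM(k)`. -/
def compatiblePairs (k : ℕ) :
    Set (Matrix (Fin (k + 1)) (Fin (k + 1)) ℤ × Matrix (Fin k) (Fin k) ℤ) :=
  {p | IsASM p.1 ∧ IsASM p.2 ∧ Compatible p.1 p.2}

theorem finite_isASM (k : ℕ) : {A : Matrix (Fin k) (Fin k) ℤ | IsASM A}.Finite := by
  have h : (Set.univ.pi fun _ : Fin k => Set.univ.pi fun _ : Fin k =>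
      Set.Icc (-1 : ℤ) 1).Finite :=
    Set.Finite.pi fun _ => Set.Finite.pi fun _ => Set.finite_Icc _ _
  refine h.subset fun A hA => ?_
  intro i _ j _
  rcases hA.1 i j with h | h | h <;> simp [h]

theorem compatiblePairs_finite (k : ℕ) : (compatiblePairs k).Finite :=
  ((finite_isASM (k + 1)).prod (finite_isASM k)).subset fun _ hp => ⟨hp.1, hp.2.1⟩

end PentagramASM

/-!
# The polynomials `F_{0,k}` as sums over compatible pairs of alternating sign matrices

The recurrence for `F_{j,k}` becomes the octahedron recurrence
`f_{m+2}(i,j) f_m(i,j) = f_{m+1}(i-1,j) f_{m+1}(i+1,j) + f_{m+1}(i,j-1) f_{m+1}(i,j+1)`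
after multiplication by monomials: `f_m(i,j) = m_{i,j,m-1} F_{3i+j,m-1}` (`octa`). The monomials of
the levels `m = 0, 1` are `m_{i,j,0}⁻¹` and `m_{i,j,0}`, and all those with `j = 0` are `1`. What
makes this work is that `m_{i,j-1,0} m_{i,j+1,0} = y_{3i+j} m_{i-1,j,0} m_{i+1,j,0}` (`mZero_mul`),
which propagates to the higher levels (`mLevel_mul`). No `F_{j,k}` vanishes, because it is a
quotient of polynomials with positive values at the point `(1, 1, …)`.

The theorem is then the formula of Robbins and Rumsey for the octahedron recurrence
(`octahedron_expansion`), proved by induction on `k`: the value `f_{k+2}(0,0)` is expressed through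
the levels `1, 2` as a sum over pairs `(B, C)`, and this has to be turned into a sum over pairs
`(A, B)` in terms of the levels `0, 1`. For a fixed `B` this is the identity `sum_monomial_eq`
`∑_A x^A = ∏ (x_{ij} x_{i+1,j+1} + x_{i,j+1} x_{i+1,j})^{B_{ij}} ∑_C x_{int}^{-C}`,
where `x_{int}` is `x` without its outer rows and columns. To prove it, encode matrices by their
corner sums. Alternating sign matrices are those whose corner sums have steps `0` or `1` and the
right boundary values, and compatibility is an interlacing condition, so that, given `B`, the corner
sums of `A` (or of `C`) can be chosen in each cell of `B` independently. In terms of corner sums the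
monomials are products of powers of the cross ratios
`r = x_{ij} x_{i+1,j+1} / (x_{i,j+1} x_{i+1,j})`, so that both sums are products over the cells, and
the identity reduces to an elementary one in each cell (`cell_sum`): the sum on the left is a power
of `r`, times `1 + r` where `B_{ij} = 1`, and the sum on the right is a power of `r`, times `1 + r`
where `B_{ij} = -1`.

It remains to translate compatibility, which is defined by order ideals, into interlacing
(`compatible_iff_interlace`). The elements of `Q_k` are parametrized by triples `(i, j, c)`, so that
an ideal consists of the triples for which `c` is at least the corner sum at `(i, j)`; the covering
relations of `P_k` become the inequalities of the interlacing condition.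
-/

namespace PentagramASM

/-! ### The monomials and the octahedron recurrence -/

section Monomials

variable {K : Type*} [Field K]

theorem intProd_self_sub_one (a : ℤ) (z : ℤ → K) : intProd a (a - 1) z = 1 := by
  simp [intProd]

theorem intProd_succ (a b : ℤ) {z : ℤ → K} (hz : ∀ i, z i ≠ 0) :
    intProd a (b + 1) z = intProd a b z * z (b + 1) := by
  unfold intProd
  rcases lt_trichotomy (b + 2) a with h | h | h
  · rw [if_neg (by omega), if_neg (by omega)]
    have : Finset.Icc (b + 1) (a - 1) = insert (b + 1) (Finset.Icc (b + 1 + 1) (a - 1)) := by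
      ext x; simp only [Finset.mem_Icc, Finset.mem_insert]; omega
    rw [this, Finset.prod_insert (by simp)]
    field_simp [hz]
  · subst h
    rw [if_pos (by omega), if_neg (by omega)]
    have h1 : Finset.Icc (b + 2) (b + 1) = ∅ := by simp
    have h2 : Finset.Icc (b + 1) (b + 2 - 1) = {b + 1} := by
      ext x; simp only [Finset.mem_Icc, Finset.mem_singleton]; omega
    rw [h1, h2]
    simp [hz]
  · rw [if_pos (by omega), if_pos (by omega)]
    have : Finset.Icc a (b + 1) = insert (b + 1) (Finset.Icc a b) := by
      ext x; simp only [Finset.mem_Icc, Finset.mem_insert]; omega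
    rw [this, Finset.prod_insert (by simp), mul_comm]

theorem intProd_ne_zero (a b : ℤ) {z : ℤ → K} (hz : ∀ i, z i ≠ 0) : intProd a b z ≠ 0 := by
  unfold intProd
  split_ifs
  · exact Finset.prod_ne_zero_iff.2 fun i _ => hz i
  · exact Finset.prod_ne_zero_iff.2 fun i _ => inv_ne_zero (hz i)

/-- The inner product `∏_{m=0}^{l} y_{N-4l+6m}` of the monomial `m_{i,j,0}`, where
`N = 3i+j-1`. -/
noncomputable def progProd (y : ℤ → K) (N l : ℤ) : K :=
  intProd 0 l fun m => y (N - 4 * l + 6 * m)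

theorem mZero_eq (y : ℤ → K) (i j : ℤ) :
    mZero y i j = intProd 0 (j - 1) (progProd y (3 * i + j - 1)) := by
  unfold mZero progProd
  congr 1; funext l; congr 1; funext m; congr 1; ring

variable {y : ℤ → K}

theorem progProd_ne_zero (hy : ∀ i, y i ≠ 0) (N l : ℤ) : progProd y N l ≠ 0 :=
  intProd_ne_zero _ _ fun _ => hy _

/-- All four progressions have step `6`; the outer two on the left are obtained from those on the
right by moving the last term of one to the other. -/
theorem progProd_mul (hy : ∀ i, y i ≠ 0) (N l : ℤ) :
    progProd y (N + 1) (l + 1) * progProd y (N - 1) (l - 1) =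
      progProd y (N - 3) l * progProd y (N + 3) l := by
  unfold progProd
  rw [intProd_succ 0 l fun _ => hy _]
  obtain ⟨l, rfl⟩ : ∃ l', l = l' + 1 := ⟨l - 1, by ring⟩
  rw [intProd_succ 0 l (z := fun m => y (N + 3 - 4 * (l + 1) + 6 * m)) fun _ => hy _]
  have e1 : (fun m => y (N + 1 - 4 * (l + 1 + 1) + 6 * m)) =
      fun m => y (N - 3 - 4 * (l + 1) + 6 * m) := by
    funext m; congr 1; ring
  have e2 : (fun m => y (N - 1 - 4 * (l + 1 - 1) + 6 * m)) =
      fun m => y (N + 3 - 4 * (l + 1) + 6 * m) := by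
    funext m; congr 1; ring
  have e3 : N + 1 - 4 * (l + 1 + 1) + 6 * (l + 1 + 1) = N + 3 - 4 * (l + 1) + 6 * (l + 1) := by
    ring
  rw [e1, e2, e3, show l + 1 - 1 = l by ring]
  ring

theorem intProd_progProd (hy : ∀ i, y i ≠ 0) (N J : ℤ) :
    intProd 0 (J - 2) (progProd y (N - 1)) * intProd 0 J (progProd y (N + 1)) =
      y (N + 1) * (intProd 0 (J - 1) (progProd y (N - 3)) *
        intProd 0 (J - 1) (progProd y (N + 3))) := by
  have step : ∀ J : ℤ,
      intProd 0 (J + 1 - 2) (progProd y (N - 1)) * intProd 0 (J + 1) (progProd y (N + 1)) =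
        intProd 0 (J - 2) (progProd y (N - 1)) * intProd 0 J (progProd y (N + 1)) *
          (progProd y (N - 3) J * progProd y (N + 3) J) ∧
      intProd 0 (J + 1 - 1) (progProd y (N - 3)) * intProd 0 (J + 1 - 1) (progProd y (N + 3)) =
        intProd 0 (J - 1) (progProd y (N - 3)) * intProd 0 (J - 1) (progProd y (N + 3)) *
          (progProd y (N - 3) J * progProd y (N + 3) J) := by
    intro J
    have h1 := intProd_succ 0 (J - 2) (progProd_ne_zero hy (N - 1))
    have h2 := intProd_succ 0 J (progProd_ne_zero hy (N + 1))
    have h3 := intProd_succ 0 (J - 1) (progProd_ne_zero hy (N - 3))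
    have h4 := intProd_succ 0 (J - 1) (progProd_ne_zero hy (N + 3))
    rw [show J - 2 + 1 = J - 1 by ring] at h1
    rw [show J - 1 + 1 = J by ring] at h3 h4
    rw [show J + 1 - 2 = J - 1 by ring, show J + 1 - 1 = J by ring, h1, h2, h3, h4]
    have h5 := progProd_mul hy N J
    constructor
    · linear_combination
        intProd 0 (J - 2) (progProd y (N - 1)) * intProd 0 J (progProd y (N + 1)) * h5
    · ring
  induction J using Int.induction_on with
  | zero =>
    have h1 := intProd_succ 0 (-2) (progProd_ne_zero hy (N - 1))
    have h2 := intProd_succ 0 (-1) (progProd_ne_zero hy (N + 1))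
    have h3 : ∀ z : ℤ → K, intProd 0 (-1) z = 1 := intProd_self_sub_one 0
    have h4 : progProd y (N - 1) (-1) = 1 := h3 _
    have h5 : progProd y (N + 1) 0 = y (N + 1) := by simp [progProd, intProd]
    norm_num at h1 h2
    rw [h3, h4, mul_one] at h1
    rw [h3, h5, one_mul] at h2
    norm_num
    rw [← h1, h2, h3, h3]
    ring
  | succ J ih =>
    rw [(step J).1, (step J).2, ih]; ring
  | pred J ih =>
    have h := step (-(J : ℤ) - 1)
    rw [show -(J : ℤ) - 1 + 1 = -J by ring] at h
    rw [h.1, h.2, ← mul_assoc (y (N + 1))] at ih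
    exact mul_right_cancel₀
      (mul_ne_zero (progProd_ne_zero hy _ _) (progProd_ne_zero hy _ _)) ih

theorem mZero_ne_zero (hy : ∀ i, y i ≠ 0) (i j : ℤ) : mZero y i j ≠ 0 := by
  rw [mZero_eq]; exact intProd_ne_zero _ _ fun _ => progProd_ne_zero hy _ _

theorem mZero_mul (hy : ∀ i, y i ≠ 0) (i j : ℤ) :
    mZero y i (j - 1) * mZero y i (j + 1) =
      y (3 * i + j) * (mZero y (i - 1) j * mZero y (i + 1) j) := by
  have h := intProd_progProd hy (3 * i + j - 1) j
  simp only [mZero_eq]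
  rw [show 3 * i + (j - 1) - 1 = 3 * i + j - 1 - 1 by ring,
    show 3 * i + (j + 1) - 1 = 3 * i + j - 1 + 1 by ring,
    show 3 * (i - 1) + j - 1 = 3 * i + j - 1 - 3 by ring,
    show 3 * (i + 1) + j - 1 = 3 * i + j - 1 + 3 by ring,
    show j - 1 - 1 = j - 2 by ring, show j + 1 - 1 = j by ring, h,
    show 3 * i + j - 1 + 1 = 3 * i + j by ring]

/-- The monomials `m_{i,j,k-1}`, indexed by `k ≥ 0`, that turn the recurrence for `F_{j,k}` into
the octahedron recurrence. The first two levels are `m_{i,j,0}⁻¹` and `m_{i,j,0}`. -/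
noncomputable def mLevel (y : ℤ → K) : ℕ → ℤ → ℤ → K
  | 0, i, j => (mZero y i j)⁻¹
  | 1, i, j => mZero y i j
  | k + 2, i, j => mLevel y (k + 1) (i - 1) j * mLevel y (k + 1) (i + 1) j / mLevel y k i j

theorem mLevel_ne_zero (hy : ∀ i, y i ≠ 0) (k : ℕ) (i j : ℤ) : mLevel y k i j ≠ 0 := by
  induction k using Nat.strong_induction_on generalizing i j with
  | _ k ih =>
    match k, ih with
    | 0, _ => exact inv_ne_zero (mZero_ne_zero hy i j)
    | 1, _ => exact mZero_ne_zero hy i j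
    | k + 2, ih =>
      exact div_ne_zero (mul_ne_zero (ih _ (by omega) _ _) (ih _ (by omega) _ _))
        (ih _ (by omega) _ _)

theorem mLevel_zero_right (k : ℕ) (i : ℤ) : mLevel y k i 0 = 1 := by
  have h0 : ∀ i, mZero y i 0 = 1 := fun i => by rw [mZero_eq]; exact intProd_self_sub_one 0 _
  induction k using Nat.strong_induction_on generalizing i with
  | _ k ih =>
    match k, ih with
    | 0, _ => simp [mLevel, h0]
    | 1, _ => exact h0 i
    | k + 2, ih => simp [mLevel, ih (k + 1) (by omega), ih k (by omega)]

/-- The coefficient `∏_{l=-k}^{k} y_{x+3l}` in the recurrence for `F_{x,k+1}`. -/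
noncomputable def coeffProd (y : ℤ → K) (k : ℕ) (x : ℤ) : K :=
  ∏ l ∈ Finset.Icc (-(k : ℤ)) k, y (x + 3 * l)

theorem coeffProd_succ (k : ℕ) (x : ℤ) :
    coeffProd y (k + 1) x = coeffProd y k x * (y (x - 3 * (k + 1)) * y (x + 3 * (k + 1))) := by
  unfold coeffProd
  have : Finset.Icc (-((k + 1 : ℕ) : ℤ)) (k + 1 : ℕ) =
      insert (-((k : ℤ) + 1)) (insert ((k : ℤ) + 1) (Finset.Icc (-(k : ℤ)) k)) := by
    ext z; simp only [Finset.mem_Icc, Finset.mem_insert]; push_cast; omega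
  rw [this, Finset.prod_insert, Finset.prod_insert]
  · rw [show x + 3 * -((k : ℤ) + 1) = x - 3 * (k + 1) by ring]; ring
  · simp
  · simp only [Finset.mem_Icc, Finset.mem_insert]; omega

theorem coeffProd_shift (k : ℕ) (x : ℤ) :
    coeffProd y k (x - 3) * y (x + 3 * k) = coeffProd y k x * y (x - 3 * (k + 1)) := by
  induction k with
  | zero => simp [coeffProd, mul_comm]
  | succ k ih =>
    rw [coeffProd_succ, coeffProd_succ]
    push_cast
    rw [show x - 3 + 3 * ((k : ℤ) + 1) = x + 3 * k by ring,
      show x - 3 - 3 * ((k : ℤ) + 1) = x - 3 * (k + 1 + 1) by ring]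
    linear_combination (y (x - 3 * (k + 1 + 1)) * y (x + 3 * (k + 1))) * ih

theorem coeffProd_ne_zero (hy : ∀ i, y i ≠ 0) (k : ℕ) (x : ℤ) : coeffProd y k x ≠ 0 :=
  Finset.prod_ne_zero_iff.2 fun _ _ => hy _

theorem coeffProd_mul (hy : ∀ i, y i ≠ 0) (k : ℕ) (x : ℤ) :
    coeffProd y (k + 2) x * coeffProd y k x =
      coeffProd y (k + 1) (x - 3) * coeffProd y (k + 1) (x + 3) := by
  have e1 := coeffProd_shift (y := y) (k + 1) x
  have e2 := coeffProd_shift (y := y) (k + 1) (x + 3)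
  have e3 := coeffProd_succ (y := y) k x
  rw [coeffProd_succ (k + 1)]
  push_cast at e1 e2 e3 ⊢
  rw [show x + 3 - 3 = x by ring, show x + 3 - 3 * ((k : ℤ) + 1 + 1) = x - 3 * (k + 1) by ring,
    show x + 3 + 3 * ((k : ℤ) + 1) = x + 3 * (k + 1 + 1) by ring] at e2
  apply mul_right_cancel₀ (mul_ne_zero (hy (x + 3 * (k + 1))) (hy (x - 3 * (k + 1))))
  linear_combination (-y (x + 3 * (k + 1 + 1)) * y (x - 3 * (k + 1 + 1)) *
    coeffProd y (k + 1) x) * e3 - (coeffProd y (k + 1) (x + 3) * y (x - 3 * (k + 1))) * e1 +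
    coeffProd y (k + 1) x * y (x - 3 * (k + 1 + 1)) * e2

/-- One step of the propagation of `mLevel_mul` from two consecutive levels `L₀`, `L₁` to the
next. -/
theorem ratio_step {L₀ L₁ : ℤ → ℤ → K} {i j : ℤ} {c₀ cl cr c₂ : K}
    (n₀ : ∀ i j, L₀ i j ≠ 0) (hc₀ : c₀ ≠ 0)
    (h₀ : L₀ i (j - 1) * L₀ i (j + 1) = c₀ * (L₀ (i - 1) j * L₀ (i + 1) j))
    (hl : L₁ (i - 1) (j - 1) * L₁ (i - 1) (j + 1) =
      cl * (L₁ (i - 1 - 1) j * L₁ (i - 1 + 1) j))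
    (hr : L₁ (i + 1) (j - 1) * L₁ (i + 1) (j + 1) =
      cr * (L₁ (i + 1 - 1) j * L₁ (i + 1 + 1) j))
    (hc : c₂ * c₀ = cl * cr) :
    L₁ (i - 1) (j - 1) * L₁ (i + 1) (j - 1) / L₀ i (j - 1) *
        (L₁ (i - 1) (j + 1) * L₁ (i + 1) (j + 1) / L₀ i (j + 1)) =
      c₂ * (L₁ (i - 1 - 1) j * L₁ (i - 1 + 1) j / L₀ (i - 1) j *
        (L₁ (i + 1 - 1) j * L₁ (i + 1 + 1) j / L₀ (i + 1) j)) := by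
  have n1 := n₀ (i - 1) j
  have n2 := n₀ (i + 1) j
  rw [div_mul_div_comm, h₀, div_mul_div_comm, ← mul_div_assoc,
    div_eq_div_iff (mul_ne_zero hc₀ (mul_ne_zero n1 n2)) (mul_ne_zero n1 n2)]
  linear_combination (L₀ (i - 1) j * L₀ (i + 1) j) *
    (L₁ (i + 1) (j - 1) * L₁ (i + 1) (j + 1) * hl +
      cl * (L₁ (i - 1 - 1) j * L₁ (i - 1 + 1) j) * hr -
      (L₁ (i - 1 - 1) j * L₁ (i - 1 + 1) j) * (L₁ (i + 1 - 1) j * L₁ (i + 1 + 1) j) * hc)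

theorem mLevel_mul (hy : ∀ i, y i ≠ 0) (k : ℕ) (i j : ℤ) :
    mLevel y (k + 1) i (j - 1) * mLevel y (k + 1) i (j + 1) =
      coeffProd y k (3 * i + j) * (mLevel y (k + 1) (i - 1) j * mLevel y (k + 1) (i + 1) j) := by
  induction k using Nat.strong_induction_on generalizing i j with
  | _ k ih =>
    have el : 3 * (i - 1) + j = 3 * i + j - 3 := by ring
    have er : 3 * (i + 1) + j = 3 * i + j + 3 := by ring
    match k, ih with
    | 0, _ => simpa [mLevel, coeffProd] using mZero_mul hy i j
    | 1, ih =>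
      have hl := ih 0 (by omega) (i - 1) j
      have hr := ih 0 (by omega) (i + 1) j
      rw [el] at hl
      rw [er] at hr
      refine ratio_step (c₀ := (y (3 * i + j))⁻¹) (mLevel_ne_zero hy 0) (inv_ne_zero (hy _)) ?_
        hl hr ?_
      · simp only [mLevel, ← mul_inv, mZero_mul hy i j]
      · rw [coeffProd_succ]
        have := hy (3 * i + j)
        simp [coeffProd]
        field_simp
    | k + 2, ih =>
      have hl := ih (k + 1) (by omega) (i - 1) j
      have hr := ih (k + 1) (by omega) (i + 1) j
      rw [el] at hl
      rw [er] at hr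
      exact ratio_step (mLevel_ne_zero hy (k + 1)) (coeffProd_ne_zero hy _ _)
        (ih k (by omega) i j) hl hr (coeffProd_mul hy k _)

/-- The rescaled values `m_{i,j,k-1} F_{3i+j,k-1}`, for `k ≥ 0`. -/
noncomputable def octa (y : ℤ → K) (k : ℕ) (i j : ℤ) : K :=
  mLevel y k i j * Faux y k (3 * i + j)

theorem octa_rec (hy : ∀ i, y i ≠ 0) (hF : ∀ k j, Faux y k j ≠ 0) (k : ℕ) (i j : ℤ) :
    octa y (k + 2) i j * octa y k i j =
      octa y (k + 1) (i - 1) j * octa y (k + 1) (i + 1) j +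
        octa y (k + 1) i (j + 1) * octa y (k + 1) i (j - 1) := by
  have hm : mLevel y (k + 2) i j * mLevel y k i j =
      mLevel y (k + 1) (i - 1) j * mLevel y (k + 1) (i + 1) j :=
    div_mul_cancel₀ _ (mLevel_ne_zero hy _ _ _)
  have hf : Faux y (k + 2) (3 * i + j) * Faux y k (3 * i + j) =
      Faux y (k + 1) (3 * i + j - 3) * Faux y (k + 1) (3 * i + j + 3) +
        coeffProd y k (3 * i + j) *
          (Faux y (k + 1) (3 * i + j - 1) * Faux y (k + 1) (3 * i + j + 1)) :=
    div_mul_cancel₀ _ (hF _ _)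
  have hr := mLevel_mul hy k i j
  unfold octa
  rw [show 3 * (i - 1) + j = 3 * i + j - 3 by ring, show 3 * (i + 1) + j = 3 * i + j + 3 by ring,
    show 3 * i + (j + 1) = 3 * i + j + 1 by ring, show 3 * i + (j - 1) = 3 * i + j - 1 by ring]
  linear_combination (Faux y (k + 2) (3 * i + j) * Faux y k (3 * i + j)) * hm +
    mLevel y (k + 1) (i - 1) j * mLevel y (k + 1) (i + 1) j * hf -
    (Faux y (k + 1) (3 * i + j - 1) * Faux y (k + 1) (3 * i + j + 1)) * hr

end Monomials

/-! ### The rational functions `F_{j,k}` do not vanish -/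

/-- An element of the fraction field is positive at one if it is a quotient of two polynomials
that take positive values at the point all of whose coordinates are `1`. -/
def PosAtOne {σ : Type*} (z : FractionRing (MvPolynomial σ ℚ)) : Prop :=
  ∃ p q : MvPolynomial σ ℚ, 0 < MvPolynomial.eval (fun _ => 1) p ∧
    0 < MvPolynomial.eval (fun _ => 1) q ∧
    z = algebraMap _ (FractionRing (MvPolynomial σ ℚ)) p / algebraMap _ _ q

section Positivity

variable {σ : Type*}

theorem algebraMap_ne_zero_of_eval_pos {p : MvPolynomial σ ℚ}
    (hp : 0 < MvPolynomial.eval (fun _ => 1) p) :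
    algebraMap _ (FractionRing (MvPolynomial σ ℚ)) p ≠ 0 := by
  intro h
  rw [map_eq_zero_iff _ (IsFractionRing.injective _ _)] at h
  simp [h] at hp

variable {z w : FractionRing (MvPolynomial σ ℚ)}

theorem PosAtOne.ne_zero (hz : PosAtOne z) : z ≠ 0 := by
  obtain ⟨p, q, hp, hq, rfl⟩ := hz
  exact div_ne_zero (algebraMap_ne_zero_of_eval_pos hp) (algebraMap_ne_zero_of_eval_pos hq)

theorem posAtOne_algebraMap {p : MvPolynomial σ ℚ}
    (hp : 0 < MvPolynomial.eval (fun _ => 1) p) :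
    PosAtOne (algebraMap _ (FractionRing (MvPolynomial σ ℚ)) p) :=
  ⟨p, 1, hp, by simp, by simp⟩

theorem PosAtOne.mul (hz : PosAtOne z) (hw : PosAtOne w) : PosAtOne (z * w) := by
  obtain ⟨p, q, hp, hq, rfl⟩ := hz
  obtain ⟨p', q', hp', hq', rfl⟩ := hw
  exact ⟨p * p', q * q', by simpa using mul_pos hp hp', by simpa using mul_pos hq hq', by
    rw [map_mul, map_mul, div_mul_div_comm]⟩

theorem PosAtOne.div (hz : PosAtOne z) (hw : PosAtOne w) : PosAtOne (z / w) := by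
  obtain ⟨p, q, hp, hq, rfl⟩ := hz
  obtain ⟨p', q', hp', hq', rfl⟩ := hw
  exact ⟨p * q', q * p', by simpa using mul_pos hp hq', by simpa using mul_pos hq hp', by
    rw [map_mul, map_mul, div_div_div_eq]⟩

theorem PosAtOne.add (hz : PosAtOne z) (hw : PosAtOne w) : PosAtOne (z + w) := by
  obtain ⟨p, q, hp, hq, rfl⟩ := hz
  obtain ⟨p', q', hp', hq', rfl⟩ := hw
  exact ⟨p * q' + q * p', q * q',
    by simpa using add_pos (mul_pos hp hq') (mul_pos hq hp'), by simpa using mul_pos hq hq', by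
    rw [div_add_div _ _ (algebraMap_ne_zero_of_eval_pos hq) (algebraMap_ne_zero_of_eval_pos hq')]
    simp⟩

theorem posAtOne_one : PosAtOne (1 : FractionRing (MvPolynomial σ ℚ)) := by
  simpa using posAtOne_algebraMap (p := (1 : MvPolynomial σ ℚ)) (by simp)

theorem posAtOne_prod {ι : Type*} (s : Finset ι) {f : ι → FractionRing (MvPolynomial σ ℚ)}
    (hf : ∀ i, PosAtOne (f i)) : PosAtOne (∏ i ∈ s, f i) :=
  Finset.prod_induction f PosAtOne (fun _ _ => PosAtOne.mul) posAtOne_one fun i _ => hf i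

end Positivity

theorem posAtOne_yVar (n : ℕ) (j : ℤ) : PosAtOne (yVar n j) :=
  posAtOne_algebraMap (by simp)

theorem posAtOne_Faux (n k : ℕ) (j : ℤ) : PosAtOne (Faux (yVar n) k j) := by
  induction k using Nat.strong_induction_on generalizing j with
  | _ k ih =>
    match k, ih with
    | 0, _ => exact posAtOne_one
    | 1, _ => exact posAtOne_one
    | k + 2, ih =>
      have h1 := ih (k + 1) (by omega)
      exact (((h1 _).mul (h1 _)).add
        ((posAtOne_prod _ fun _ => posAtOne_yVar n _).mul ((h1 _).mul (h1 _)))).div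
          (ih k (by omega) _)

theorem octa_ne_zero (n k : ℕ) (i j : ℤ) : octa (yVar n) k i j ≠ 0 :=
  mul_ne_zero (mLevel_ne_zero (fun j => (posAtOne_yVar n j).ne_zero) _ _ _)
    (posAtOne_Faux n k _).ne_zero

/-! ### Corner sums of alternating sign matrices -/

/-- The mixed second difference of a function of two indices, at the unit cell whose upper left
corner is `(i, j)`. -/
def mixedDiff (c : ℕ → ℕ → ℤ) (i j : ℕ) : ℤ :=
  c (i + 1) (j + 1) - c (i + 1) j - c i (j + 1) + c i j

/-- A matrix extended by zero to all pairs of natural numbers. -/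
def extend {n : ℕ} (A : Matrix (Fin n) (Fin n) ℤ) (i j : ℕ) : ℤ :=
  if h : i < n ∧ j < n then A ⟨i, h.1⟩ ⟨j, h.2⟩ else 0

/-- The corner sum `∑_{a < i, b < j} A_{ab}`. -/
def cornerSum {n : ℕ} (A : Matrix (Fin n) (Fin n) ℤ) (i j : ℕ) : ℤ :=
  ∑ a ∈ Finset.range i, ∑ b ∈ Finset.range j, extend A a b

section

variable {n : ℕ} (A : Matrix (Fin n) (Fin n) ℤ)

@[simp] theorem extend_val (i j : Fin n) : extend A i j = A i j := by
  simp [extend]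

theorem extend_of_le_left {i j : ℕ} (h : n ≤ i) : extend A i j = 0 :=
  dif_neg fun h' => by omega

theorem extend_of_le_right {i j : ℕ} (h : n ≤ j) : extend A i j = 0 :=
  dif_neg fun h' => by omega

@[simp] theorem cornerSum_zero_left (j : ℕ) : cornerSum A 0 j = 0 := by
  simp [cornerSum]

@[simp] theorem cornerSum_zero_right (i : ℕ) : cornerSum A i 0 = 0 := by
  simp [cornerSum]

theorem cornerSum_succ_left (i j : ℕ) :
    cornerSum A (i + 1) j = cornerSum A i j + ∑ b ∈ Finset.range j, extend A i b := by
  simp [cornerSum, Finset.sum_range_succ]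

theorem cornerSum_succ_right (i j : ℕ) :
    cornerSum A i (j + 1) = cornerSum A i j + ∑ a ∈ Finset.range i, extend A a j := by
  simp [cornerSum, Finset.sum_range_succ, Finset.sum_add_distrib]

theorem mixedDiff_cornerSum (i j : ℕ) : mixedDiff (cornerSum A) i j = extend A i j := by
  simp only [mixedDiff, cornerSum_succ_left, Finset.sum_range_succ]
  ring

end

theorem cornerSum_of_mixedDiff {n : ℕ} {A : Matrix (Fin n) (Fin n) ℤ} {c : ℕ → ℕ → ℤ}
    (hl : ∀ j ≤ n, c 0 j = 0) (hr : ∀ i ≤ n, c i 0 = 0)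
    (hA : ∀ i j : Fin n, A i j = mixedDiff c i j) {i j : ℕ} (hi : i ≤ n) (hj : j ≤ n) :
    cornerSum A i j = c i j := by
  induction i generalizing j with
  | zero => simp [hl j hj]
  | succ i ih =>
    induction j with
    | zero => simp [hr (i + 1) hi]
    | succ j ihj =>
      have h1 := mixedDiff_cornerSum A i j
      have h2 : extend A i j = mixedDiff c i j := by
        rw [← hA ⟨i, by omega⟩ ⟨j, by omega⟩, ← extend_val A]
      rw [h2, mixedDiff, mixedDiff, ihj (by omega), ih (by omega) hj,
        ih (by omega) (by omega)] at h1
      omega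

/-- The conditions that characterize the corner sums of `n × n` alternating sign matrices: the
boundary values, and steps `0` or `1` in each direction. -/
structure IsCorner (n : ℕ) (c : ℕ → ℕ → ℤ) : Prop where
  zero_left : ∀ j ≤ n, c 0 j = 0
  zero_right : ∀ i ≤ n, c i 0 = 0
  last_left : ∀ j ≤ n, c n j = j
  last_right : ∀ i ≤ n, c i n = i
  step_left : ∀ i < n, ∀ j ≤ n, c (i + 1) j = c i j ∨ c (i + 1) j = c i j + 1
  step_right : ∀ i ≤ n, ∀ j < n, c i (j + 1) = c i j ∨ c i (j + 1) = c i j + 1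

/-! ### Sequences whose nonzero terms alternate in sign -/

/-- A sequence whose nonzero terms alternate in the sense of `IsASM` and which has sum `1` has all
its partial sums in `{0, 1}`. -/
theorem partialSum_of_alternating {n : ℕ} {v : ℕ → ℤ}
    (h2 : ∀ j j', j < j' → j' < n → v j ≠ 0 → v j' ≠ 0 → (∀ l, j < l → l < j' → v l = 0) →
      v j' = -v j)
    (h3 : ∑ j ∈ Finset.range n, v j = 1) {m : ℕ} (hm : m ≤ n) :
    ∑ j ∈ Finset.range m, v j = 0 ∨ ∑ j ∈ Finset.range m, v j = 1 := by
  -- All partial sums are `0` or the first nonzero term `e`, according to the last nonzero term.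
  have key : ∀ m ≤ n, (∀ l ≤ m, ∑ j ∈ Finset.range l, v j = 0) ∧ (∀ j < m, v j = 0) ∨
      ∃ e : ℤ, e ≠ 0 ∧ (∀ l ≤ m, ∑ j ∈ Finset.range l, v j = 0 ∨ ∑ j ∈ Finset.range l, v j = e) ∧
        ∃ i < m, (∀ l, i < l → l < m → v l = 0) ∧
          (v i = e ∧ ∑ j ∈ Finset.range m, v j = e ∨
            v i = -e ∧ ∑ j ∈ Finset.range m, v j = 0) := by
    intro m
    induction m with
    | zero => intro _; left; simp
    | succ m ih =>
      intro hm
      have hs := Finset.sum_range_succ v m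
      rcases ih (by omega) with ⟨ha, hb⟩ | ⟨e, he, ha, i, hi, hz, hc⟩
      · by_cases hv : v m = 0
        · left
          constructor
          · intro l hl
            rcases Nat.lt_or_ge m l with h | h
            · obtain rfl : l = m + 1 := by omega
              rw [hs, hv, ha m le_rfl, add_zero]
            · exact ha l h
          · intro j hj
            rcases Nat.lt_or_ge j m with h | h
            · exact hb j h
            · obtain rfl : j = m := by omega
              exact hv
        · right
          refine ⟨v m, hv, ?_, m, by omega, fun l h h' => by omega, Or.inl ⟨rfl, ?_⟩⟩
          · intro l hl
            rcases Nat.lt_or_ge m l with h | h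
            · obtain rfl : l = m + 1 := by omega
              right; rw [hs, ha m le_rfl, zero_add]
            · exact Or.inl (ha l h)
          · rw [hs, ha m le_rfl, zero_add]
      · right
        by_cases hv : v m = 0
        · rw [hv, add_zero] at hs
          refine ⟨e, he, ?_, i, by omega, ?_, by rwa [hs]⟩
          · intro l hl
            rcases Nat.lt_or_ge m l with h | h
            · obtain rfl : l = m + 1 := by omega
              rw [hs]; exact ha m le_rfl
            · exact ha l h
          · intro l h h'
            rcases Nat.lt_or_ge l m with h'' | h''
            · exact hz l h h''
            · obtain rfl : l = m := by omega
              exact hv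
        · have hvi : v i ≠ 0 := by rcases hc with ⟨h, _⟩ | ⟨h, _⟩ <;> rw [h] <;> simpa using he
          have halt := h2 i m hi (by omega) hvi hv hz
          have hlast : v m = e ∧ ∑ j ∈ Finset.range (m + 1), v j = e ∨
              v m = -e ∧ ∑ j ∈ Finset.range (m + 1), v j = 0 := by
            rw [hs]; omega
          refine ⟨e, he, ?_, m, by omega, fun l h h' => by omega, hlast⟩
          intro l hl
          rcases Nat.lt_or_ge m l with h | h
          · obtain rfl : l = m + 1 := by omega
            omega
          · exact ha l h
  rcases key n le_rfl with ⟨ha, -⟩ | ⟨e, he, ha, -⟩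
  · exact Or.inl (ha m hm)
  · have := ha n le_rfl
    obtain rfl : e = 1 := by omega
    exact ha m hm

/-- Conversely, partial sums `p` in `{0, 1}` force the nonzero differences to alternate. -/
theorem alternating_of_partialSum {n : ℕ} {p : ℕ → ℤ} (hp : ∀ m ≤ n, p m = 0 ∨ p m = 1)
    {j j' : ℕ} (hj : j < j') (hj' : j' < n) (h : p (j + 1) - p j ≠ 0)
    (h' : p (j' + 1) - p j' ≠ 0) (hz : ∀ l, j < l → l < j' → p (l + 1) - p l = 0) :
    p (j' + 1) - p j' = -(p (j + 1) - p j) := by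
  have hc : ∀ d, j + 1 + d ≤ j' → p (j + 1 + d) = p (j + 1) := by
    intro d
    induction d with
    | zero => simp
    | succ d ih =>
      intro hd
      have := hz (j + 1 + d) (by omega) (by omega)
      rw [← ih (by omega)]
      rw [show j + 1 + (d + 1) = j + 1 + d + 1 by ring]
      omega
  have h1 := hc (j' - (j + 1)) (by omega)
  rw [show j + 1 + (j' - (j + 1)) = j' by omega] at h1
  have h2 := hp j (by omega)
  have h3 := hp j' (by omega)
  have h4 := hp (j' + 1) (by omega)
  omega

theorem sum_extend_row {n : ℕ} (A : Matrix (Fin n) (Fin n) ℤ) (i : Fin n) :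
    ∑ b ∈ Finset.range n, extend A i b = ∑ b, A i b := by
  rw [Finset.sum_range]; simp

theorem sum_extend_col {n : ℕ} (A : Matrix (Fin n) (Fin n) ℤ) (j : Fin n) :
    ∑ a ∈ Finset.range n, extend A a j = ∑ a, A a j := by
  rw [Finset.sum_range]; simp

theorem IsASM.isCorner {n : ℕ} {A : Matrix (Fin n) (Fin n) ℤ} (hA : IsASM A) :
    IsCorner n (cornerSum A) := by
  obtain ⟨-, h2, h3, h4, h5⟩ := hA
  have hrow : ∀ i < n, ∑ b ∈ Finset.range n, extend A i b = 1 := fun i hi => by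
    rw [sum_extend_row A ⟨i, hi⟩, h4]
  have hcol : ∀ j < n, ∑ a ∈ Finset.range n, extend A a j = 1 := fun j hj => by
    rw [sum_extend_col A ⟨j, hj⟩, h5]
  refine ⟨fun j _ => cornerSum_zero_left A j, fun i _ => cornerSum_zero_right A i, ?_, ?_, ?_, ?_⟩
  · intro j hj
    induction j with
    | zero => simp
    | succ j ih => rw [cornerSum_succ_right, ih (by omega), hcol j (by omega)]; simp
  · intro i hi
    induction i with
    | zero => simp
    | succ i ih => rw [cornerSum_succ_left, ih (by omega), hrow i (by omega)]; simp
  · intro i hi j hj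
    rw [cornerSum_succ_left]
    have := partialSum_of_alternating (n := n) (v := extend A i)
      (fun j j' hjj hj' => by
        have hj : j < n := by omega
        intro hv hv' hz
        have := h2 ⟨i, hi⟩ ⟨j, hj⟩ ⟨j', hj'⟩ hjj (by rwa [← extend_val A])
          (by rwa [← extend_val A]) fun l hl hl' => by
            rw [← extend_val A]; exact hz l hl hl'
        rwa [← extend_val A, ← extend_val A] at this)
      (hrow i hi) hj
    omega
  · intro i hi j hj
    rw [cornerSum_succ_right]
    have := partialSum_of_alternating (n := n) (v := fun a => extend A a j)
      (fun i i' hii hi' => by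
        have hi : i < n := by omega
        intro hv hv' hz
        have := h3 ⟨j, hj⟩ ⟨i, hi⟩ ⟨i', hi'⟩ hii (by rwa [← extend_val A])
          (by rwa [← extend_val A]) fun l hl hl' => by
            rw [← extend_val A]; exact hz l hl hl'
        rwa [← extend_val A, ← extend_val A] at this)
      (hcol j hj) hi
    omega

theorem IsCorner.isASM {n : ℕ} {A : Matrix (Fin n) (Fin n) ℤ} {c : ℕ → ℕ → ℤ}
    (hc : IsCorner n c) (hA : ∀ i j : Fin n, A i j = mixedDiff c i j) : IsASM A := by
  have hrow : ∀ i j : Fin n, A i j =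
      (c (i + 1) (j + 1) - c i (j + 1)) - (c (i + 1) j - c i j) := fun i j => by
    rw [hA, mixedDiff]; ring
  have hcol : ∀ i j : Fin n, A i j =
      (c (i + 1) (j + 1) - c (i + 1) j) - (c i (j + 1) - c i j) := fun i j => by
    rw [hA, mixedDiff]; ring
  have hl : ∀ i : Fin n, ∀ m ≤ n, c (i + 1) m - c i m = 0 ∨ c (i + 1) m - c i m = 1 :=
    fun i m hm => by have := hc.step_left i i.2 m hm; omega
  have hr : ∀ j : Fin n, ∀ m ≤ n, c m (j + 1) - c m j = 0 ∨ c m (j + 1) - c m j = 1 :=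
    fun j m hm => by have := hc.step_right m hm j j.2; omega
  refine ⟨?_, ?_, ?_, ?_, ?_⟩
  · intro i j
    rw [hrow]
    have := hl i (j + 1) j.2
    have := hl i j j.2.le
    omega
  · intro i j j' hjj h h' hz
    rw [hrow] at h h' ⊢
    rw [hrow]
    refine alternating_of_partialSum (p := fun m => c (i + 1) m - c i m) (hl i) hjj j'.2 h h' ?_
    intro l hl hl'
    rw [← hz ⟨l, by omega⟩ hl hl', hrow]
  · intro j i i' hii h h' hz
    rw [hcol] at h h' ⊢
    rw [hcol]
    refine alternating_of_partialSum (p := fun m => c m (j + 1) - c m j) (hr j) hii i'.2 h h' ?_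
    intro l hl hl'
    rw [← hz ⟨l, by omega⟩ hl hl', hcol]
  · intro i
    simp only [hrow]
    rw [← Finset.sum_range (fun j => (c (i + 1) (j + 1) - c i (j + 1)) - (c (i + 1) j - c i j)),
      Finset.sum_range_sub (fun j => c (i + 1) j - c i j), hc.last_right _ i.2,
      hc.last_right _ i.2.le, hc.zero_right _ i.2, hc.zero_right _ i.2.le]
    push_cast; ring
  · intro j
    simp only [hcol]
    rw [← Finset.sum_range (fun i => (c (i + 1) (j + 1) - c (i + 1) j) - (c i (j + 1) - c i j)),
      Finset.sum_range_sub (fun i => c i (j + 1) - c i j), hc.last_left _ j.2,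
      hc.last_left _ j.2.le, hc.zero_left _ j.2, hc.zero_left _ j.2.le]
    push_cast; ring

/-! ### Interlacing corner sums -/

/-- The corner sums `a` of a matrix of size `k + 1` interlace the corner sums `b` of a matrix of
size `k`. -/
def Interlace (k : ℕ) (a b : ℕ → ℕ → ℤ) : Prop :=
  ∀ i ≤ k, ∀ j ≤ k, a i j ≤ b i j ∧ a (i + 1) (j + 1) ≤ b i j + 1 ∧
    b i j ≤ a (i + 1) j ∧ b i j ≤ a i (j + 1)

/-- A function with the boundary values of corner sums that interlaces a smaller one also has
steps `0` and `1`. -/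
theorem Interlace.isCorner_left {k : ℕ} {a b : ℕ → ℕ → ℤ} (h : Interlace k a b)
    (zl : ∀ j ≤ k + 1, a 0 j = 0) (zr : ∀ i ≤ k + 1, a i 0 = 0)
    (ll : ∀ j ≤ k + 1, a (k + 1) j = j) (lr : ∀ i ≤ k + 1, a i (k + 1) = i) :
    IsCorner (k + 1) a := by
  refine ⟨zl, zr, ll, lr, ?_, ?_⟩
  · intro i hi j hj
    have h1 : a i j ≤ a (i + 1) j := by
      rcases Nat.lt_or_ge k j with hk | hk
      · obtain rfl : j = k + 1 := by omega
        rw [lr i hi.le, lr (i + 1) hi]; omega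
      · have := h i (by omega) j hk; omega
    have h2 : a (i + 1) j ≤ a i j + 1 := by
      cases j with
      | zero => rw [zr i hi.le, zr (i + 1) hi]; omega
      | succ j => have := h i (by omega) j (by omega); omega
    omega
  · intro i hi j hj
    have h1 : a i j ≤ a i (j + 1) := by
      rcases Nat.lt_or_ge k i with hk | hk
      · obtain rfl : i = k + 1 := by omega
        rw [ll j hj.le, ll (j + 1) hj]; omega
      · have := h i hk j (by omega); omega
    have h2 : a i (j + 1) ≤ a i j + 1 := by
      cases i with
      | zero => rw [zl j hj.le, zl (j + 1) hj]; omega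
      | succ i => have := h i (by omega) j (by omega); omega
    omega

theorem Interlace.isCorner_right {k : ℕ} {b c : ℕ → ℕ → ℤ} (h : Interlace k b c)
    (hb : IsCorner (k + 1) b) : IsCorner k c := by
  refine ⟨?_, ?_, ?_, ?_, ?_, ?_⟩
  · intro j hj
    have := h 0 (by omega) j hj
    have := hb.zero_left j (by omega)
    have := hb.zero_left (j + 1) (by omega)
    omega
  · intro i hi
    have := h i hi 0 (by omega)
    have := hb.zero_right i (by omega)
    have := hb.zero_right (i + 1) (by omega)
    omega
  · intro j hj
    have := h k le_rfl j hj
    have := hb.last_left j (by omega)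
    have := hb.last_left (j + 1) (by omega)
    push_cast at *
    omega
  · intro i hi
    have := h i hi k le_rfl
    have := hb.last_right i (by omega)
    have := hb.last_right (i + 1) (by omega)
    push_cast at *
    omega
  · intro i hi j hj
    have := h i (by omega) j hj
    have := h (i + 1) (by omega) j hj
    omega
  · intro i hi j hj
    have := h i hi j (by omega)
    have := h i hi (j + 1) (by omega)
    omega

/-! ### Summation by parts for monomials -/

section ByParts

variable {K : Type*} [Field K]

theorem prod_zpow_sub {x : ℕ → K} (hx : ∀ p, x p ≠ 0) (c : ℕ → ℤ) (m : ℕ) :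
    (∏ p ∈ Finset.range (m + 1), x p ^ (c (p + 1) - c p)) * x 0 ^ c 0 =
      (∏ i ∈ Finset.range m, (x i / x (i + 1)) ^ c (i + 1)) * x m ^ c (m + 1) := by
  induction m with
  | zero => simp [zpow_sub₀ (hx 0), zpow_ne_zero _ (hx 0)]
  | succ m ih =>
    rw [Finset.prod_range_succ, mul_right_comm, ih, Finset.prod_range_succ, zpow_sub₀ (hx _),
      div_zpow]
    have := zpow_ne_zero (c (m + 1)) (hx (m + 1))
    field_simp

theorem prod_zpow_sub_of_zero {x : ℕ → K} (hx : ∀ p, x p ≠ 0) {c : ℕ → ℤ} {m : ℕ}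
    (h0 : c 0 = 0) (hm : c (m + 1) = 0) :
    ∏ p ∈ Finset.range (m + 1), x p ^ (c (p + 1) - c p) =
      ∏ i ∈ Finset.range m, (x i / x (i + 1)) ^ c (i + 1) := by
  simpa [h0, hm] using prod_zpow_sub hx c m

/-- The monomial `∏_{p,q<N} x_{pq}^{e_{pq}}` whose exponents `e` are the mixed differences of
`c`. -/
def cornerMonomial (N : ℕ) (x : ℕ → ℕ → K) (c : ℕ → ℕ → ℤ) : K :=
  ∏ p ∈ Finset.range N, ∏ q ∈ Finset.range N, x p q ^ mixedDiff c p q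

/-- The cross ratio of the four corners of the cell with upper left corner `(i, j)`. -/
def crossRatio (x : ℕ → ℕ → K) (i j : ℕ) : K :=
  x i j * x (i + 1) (j + 1) / (x i (j + 1) * x (i + 1) j)

variable {x : ℕ → ℕ → K}

theorem cornerMonomial_ne_zero (hx : ∀ p q, x p q ≠ 0) (N : ℕ) (c : ℕ → ℕ → ℤ) :
    cornerMonomial N x c ≠ 0 :=
  Finset.prod_ne_zero_iff.2 fun _ _ => Finset.prod_ne_zero_iff.2 fun _ _ => zpow_ne_zero _ (hx _ _)

theorem cornerMonomial_add (hx : ∀ p q, x p q ≠ 0) (N : ℕ) (c d : ℕ → ℕ → ℤ) :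
    cornerMonomial N x (fun i j => c i j + d i j) =
      cornerMonomial N x c * cornerMonomial N x d := by
  unfold cornerMonomial
  simp only [← Finset.prod_mul_distrib, ← zpow_add₀ (hx _ _)]
  refine Finset.prod_congr rfl fun p _ => Finset.prod_congr rfl fun q _ => ?_
  congr 1
  simp only [mixedDiff]
  ring

theorem cornerMonomial_of_zero (hx : ∀ p q, x p q ≠ 0) {m : ℕ} {e : ℕ → ℕ → ℤ}
    (zl : ∀ j ≤ m + 1, e 0 j = 0) (zr : ∀ i ≤ m + 1, e i 0 = 0)
    (ll : ∀ j ≤ m + 1, e (m + 1) j = 0) (lr : ∀ i ≤ m + 1, e i (m + 1) = 0) :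
    cornerMonomial (m + 1) x e =
      ∏ p : Fin m × Fin m, crossRatio x p.1 p.2 ^ e (p.1 + 1) (p.2 + 1) := by
  have h1 : ∀ p ∈ Finset.range (m + 1), ∏ q ∈ Finset.range (m + 1), x p q ^ mixedDiff e p q =
      ∏ j ∈ Finset.range m, (x p j / x p (j + 1)) ^ (e (p + 1) (j + 1) - e p (j + 1)) := by
    intro p hp
    rw [Finset.mem_range] at hp
    rw [← prod_zpow_sub_of_zero (hx p) (c := fun q => e (p + 1) q - e p q)
      (by simp [zr p hp.le, zr (p + 1) hp]) (by simp [lr p hp.le, lr (p + 1) hp])]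
    refine Finset.prod_congr rfl fun q _ => ?_
    congr 1
    simp only [mixedDiff]
    ring
  unfold cornerMonomial
  rw [Finset.prod_congr rfl h1, Finset.prod_comm, Fintype.prod_prod_type_right, Finset.prod_range]
  refine Finset.prod_congr rfl fun j _ => ?_
  rw [prod_zpow_sub_of_zero (fun p => div_ne_zero (hx p j) (hx p (j + 1)))
    (c := fun p => e p (j + 1)) (zl _ (by omega)) (ll _ (by omega)), Finset.prod_range]
  refine Finset.prod_congr rfl fun i _ => ?_
  rw [crossRatio, div_div_div_eq]

theorem cornerMonomial_cornerSum {n : ℕ} (A : Matrix (Fin n) (Fin n) ℤ) :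
    cornerMonomial n x (cornerSum A) = ∏ i : Fin n, ∏ j : Fin n, x i j ^ A i j := by
  simp only [cornerMonomial, mixedDiff_cornerSum, Finset.prod_range, extend_val]

/-- Truncated subtraction in the indices is harmless, as corner sums vanish on the axes. -/
theorem cornerMonomial_shift_both {n : ℕ} (C : Matrix (Fin n) (Fin n) ℤ) :
    cornerMonomial (n + 2) x (fun i j => cornerSum C (i - 1) (j - 1)) =
      ∏ i : Fin n, ∏ j : Fin n, x (i + 1) (j + 1) ^ C i j := by
  have h0 : ∀ q, mixedDiff (fun i j => cornerSum C (i - 1) (j - 1)) 0 q = 0 := by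
    simp [mixedDiff]
  have h0' : ∀ p, mixedDiff (fun i j => cornerSum C (i - 1) (j - 1)) p 0 = 0 := by
    simp [mixedDiff]
  have h1 : ∀ p q, mixedDiff (fun i j => cornerSum C (i - 1) (j - 1)) (p + 1) (q + 1) =
      extend C p q := fun p q => by rw [← mixedDiff_cornerSum]; rfl
  have h2 : ∀ q, extend C n q = 0 := fun q => extend_of_le_left C le_rfl
  have h3 : ∀ q, extend C q n = 0 := fun q => extend_of_le_right C le_rfl
  unfold cornerMonomial
  rw [Finset.prod_range_succ', Finset.prod_range_succ]
  simp only [Finset.prod_range_succ' _ (n + 1), Finset.prod_range_succ _ n, h0, h0', h1, h2, h3,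
    zpow_zero, Finset.prod_const_one, mul_one]
  simp only [Finset.prod_range, extend_val]

theorem cornerMonomial_shift_right {n : ℕ} (B : Matrix (Fin n) (Fin n) ℤ) :
    cornerMonomial (n + 1) x (fun i j => cornerSum B i (j - 1)) =
      ∏ i : Fin n, ∏ j : Fin n, x i (j + 1) ^ B i j := by
  have h0' : ∀ p, mixedDiff (fun i j => cornerSum B i (j - 1)) p 0 = 0 := by
    simp [mixedDiff]
  have h1 : ∀ p q, mixedDiff (fun i j => cornerSum B i (j - 1)) p (q + 1) =
      extend B p q := fun p q => by rw [← mixedDiff_cornerSum]; rfl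
  have h2 : ∀ q, extend B n q = 0 := fun q => extend_of_le_left B le_rfl
  unfold cornerMonomial
  rw [Finset.prod_range_succ]
  simp only [Finset.prod_range_succ' _ n, h0', h1, h2,
    zpow_zero, Finset.prod_const_one, mul_one]
  simp only [Finset.prod_range, extend_val]

theorem cornerMonomial_shift_left {n : ℕ} (B : Matrix (Fin n) (Fin n) ℤ) :
    cornerMonomial (n + 1) x (fun i j => cornerSum B (i - 1) j) =
      ∏ i : Fin n, ∏ j : Fin n, x (i + 1) j ^ B i j := by
  have h0 : ∀ q, mixedDiff (fun i j => cornerSum B (i - 1) j) 0 q = 0 := by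
    simp [mixedDiff]
  have h1 : ∀ p q, mixedDiff (fun i j => cornerSum B (i - 1) j) (p + 1) q =
      extend B p q := fun p q => by rw [← mixedDiff_cornerSum]; rfl
  have h3 : ∀ q, extend B q n = 0 := fun q => extend_of_le_right B le_rfl
  unfold cornerMonomial
  rw [Finset.prod_range_succ']
  simp only [Finset.prod_range_succ _ n, h0, h1, h3,
    zpow_zero, Finset.prod_const_one, mul_one]
  simp only [Finset.prod_range, extend_val]

end ByParts

/-! ### Comparing monomials of interlacing matrices -/

/-- The boundary values of the corner sums of an `n × n` alternating sign matrix, including those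
with an index beyond `n`. -/
structure CornerBoundary (n : ℕ) (c : ℕ → ℕ → ℤ) : Prop where
  zero_left : ∀ j, c 0 j = 0
  zero_right : ∀ i, c i 0 = 0
  last_left : ∀ i j, n ≤ i → c i j = min (j : ℤ) n
  last_right : ∀ i j, n ≤ j → c i j = min (i : ℤ) n

theorem cornerBoundary_min (n : ℕ) :
    CornerBoundary n (fun i j => min (min (i : ℤ) j) n) := by
  constructor <;> intros <;> omega

theorem cornerSum_of_le_left {n : ℕ} (A : Matrix (Fin n) (Fin n) ℤ) {i : ℕ} (hi : n ≤ i) (j : ℕ) :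
    cornerSum A i j = cornerSum A n j := by
  induction i, hi using Nat.le_induction with
  | base => rfl
  | succ i hi ih =>
    rw [cornerSum_succ_left, ih]
    simp [extend_of_le_left A hi]

theorem cornerSum_of_le_right {n : ℕ} (A : Matrix (Fin n) (Fin n) ℤ) {j : ℕ} (hj : n ≤ j) (i : ℕ) :
    cornerSum A i j = cornerSum A i n := by
  induction j, hj using Nat.le_induction with
  | base => rfl
  | succ j hj ih =>
    rw [cornerSum_succ_right, ih]
    simp [extend_of_le_right A hj]

theorem IsASM.cornerBoundary {n : ℕ} {A : Matrix (Fin n) (Fin n) ℤ} (hA : IsASM A) :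
    CornerBoundary n (cornerSum A) := by
  have h := hA.isCorner
  refine ⟨cornerSum_zero_left A, cornerSum_zero_right A, ?_, ?_⟩
  · intro i j hi
    rw [cornerSum_of_le_left A hi]
    rcases le_total j n with hj | hj
    · rw [h.last_left j hj]; omega
    · rw [cornerSum_of_le_right A hj, h.last_left n le_rfl]; omega
  · intro i j hj
    rw [cornerSum_of_le_right A hj]
    rcases le_total i n with hi | hi
    · rw [h.last_right i hi]; omega
    · rw [cornerSum_of_le_left A hi, h.last_right n le_rfl]; omega

section Compare

variable {K : Type*} [Field K] {x : ℕ → ℕ → K}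

theorem crossRatio_ne_zero (hx : ∀ p q, x p q ≠ 0) (i j : ℕ) : crossRatio x i j ≠ 0 :=
  div_ne_zero (mul_ne_zero (hx _ _) (hx _ _)) (mul_ne_zero (hx _ _) (hx _ _))

/-- The exponent `e = a + c - b - b`, suitably shifted, vanishes on the boundary, so that
summation by parts applies to it. -/
theorem cornerMonomial_mul (hx : ∀ p q, x p q ≠ 0) {n : ℕ} {a b c : ℕ → ℕ → ℤ}
    (ha : CornerBoundary (n + 2) a) (hb : CornerBoundary (n + 1) b) (hc : CornerBoundary n c) :
    cornerMonomial (n + 2) x a * cornerMonomial (n + 2) x (fun i j => c (i - 1) (j - 1)) =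
      cornerMonomial (n + 2) x (fun i j => b i (j - 1)) *
        cornerMonomial (n + 2) x (fun i j => b (i - 1) j) *
        ∏ p : Fin (n + 1) × Fin (n + 1), crossRatio x p.1 p.2 ^
          (a (p.1 + 1) (p.2 + 1) + c p.1 p.2 - (b (p.1 + 1) p.2 + b p.1 (p.2 + 1))) := by
  obtain ⟨a1, a2, a3, a4⟩ := ha
  obtain ⟨b1, b2, b3, b4⟩ := hb
  obtain ⟨c1, c2, c3, c4⟩ := hc
  have := cornerMonomial_of_zero hx (m := n + 1)
    (e := fun i j => a i j + c (i - 1) (j - 1) - (b i (j - 1) + b (i - 1) j)) ?_ ?_ ?_ ?_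
  · simp only [Nat.add_sub_cancel] at this
    rw [← this, ← cornerMonomial_add hx, ← cornerMonomial_add hx, ← cornerMonomial_add hx]
    congr 1
    funext i j
    ring
  · intro j _
    simp [a1, b1, c1]
  · intro j _
    simp [a2, b2, c2]
  · intro j hj
    rcases Nat.eq_zero_or_pos j with rfl | h
    · simp [a2, b2, c2]
    · simp only [Nat.add_sub_cancel]
      rw [a3 _ _ (by omega), b3 _ _ (by omega), b3 _ _ (by omega), c3 _ _ (by omega)]
      omega
  · intro j hj
    rcases Nat.eq_zero_or_pos j with rfl | h
    · simp [a1, b1, c1]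
    · simp only [Nat.add_sub_cancel]
      rw [a4 _ _ (by omega), b4 _ _ (by omega), b4 _ _ (by omega), c4 _ _ (by omega)]
      omega

theorem cornerMonomial_eq_left (hx : ∀ p q, x p q ≠ 0) {n : ℕ} {a a₀ : ℕ → ℕ → ℤ}
    (ha : CornerBoundary (n + 2) a) (ha₀ : CornerBoundary (n + 2) a₀) :
    cornerMonomial (n + 2) x a = cornerMonomial (n + 2) x a₀ *
        ∏ p : Fin (n + 1) × Fin (n + 1), crossRatio x p.1 p.2 ^
          (a (p.1 + 1) (p.2 + 1) - a₀ (p.1 + 1) (p.2 + 1)) := by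
  have := cornerMonomial_of_zero hx (m := n + 1) (e := fun i j => a i j - a₀ i j)
    (fun j _ => by simp [ha.zero_left, ha₀.zero_left])
    (fun j _ => by simp [ha.zero_right, ha₀.zero_right])
    (fun j _ => by rw [ha.last_left _ _ le_rfl, ha₀.last_left _ _ le_rfl, sub_self])
    (fun j _ => by rw [ha.last_right _ _ le_rfl, ha₀.last_right _ _ le_rfl, sub_self])
  rw [← this, ← cornerMonomial_add hx]
  congr 1
  funext i j
  ring

theorem cornerMonomial_eq_right (hx : ∀ p q, x p q ≠ 0) {n : ℕ} {c c₀ : ℕ → ℕ → ℤ}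
    (hc : CornerBoundary n c) (hc₀ : CornerBoundary n c₀) :
    cornerMonomial (n + 2) x (fun i j => c (i - 1) (j - 1)) =
      cornerMonomial (n + 2) x (fun i j => c₀ (i - 1) (j - 1)) *
        ∏ p : Fin (n + 1) × Fin (n + 1), crossRatio x p.1 p.2 ^ (c p.1 p.2 - c₀ p.1 p.2) := by
  have := cornerMonomial_of_zero hx (m := n + 1)
    (e := fun i j => c (i - 1) (j - 1) - c₀ (i - 1) (j - 1))
    (fun j _ => by simp [hc.zero_left, hc₀.zero_left])
    (fun j _ => by simp [hc.zero_right, hc₀.zero_right])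
    (fun j _ => by
      simp only [Nat.add_sub_cancel]
      rw [hc.last_left _ _ (by omega), hc₀.last_left _ _ (by omega), sub_self])
    (fun j _ => by
      simp only [Nat.add_sub_cancel]
      rw [hc.last_right _ _ (by omega), hc₀.last_right _ _ (by omega), sub_self])
  simp only [Nat.add_sub_cancel] at this
  rw [← this, ← cornerMonomial_add hx]
  congr 1
  funext i j
  ring

/-- The local form of the key identity, at a cell of `B` with corner sums `u`, `w`, `v`, `z`: the
left side has two terms if the entry `z - v - w + u` is `1`, the right side if it is `-1`. -/
theorem cell_sum {r : K} (hr : r ≠ 0) (hr1 : 1 + r ≠ 0) {u v w z : ℤ}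
    (huv : v = u ∨ v = u + 1) (huw : w = u ∨ w = u + 1) (hvz : z = v ∨ z = v + 1)
    (hwz : z = w ∨ z = w + 1) :
    ∑ t ∈ Finset.Icc (max (z - 1) (max v w)) (min (u + 1) z), r ^ t =
      (1 + r) ^ (z - v - w + u) * r ^ (v + w) *
        ∑ t ∈ Finset.Icc (max u (z - 1)) (min v w), r ^ (-t) := by
  have one : ∀ (f : ℤ → K) (lo hi t : ℤ), lo = t → hi = t → ∑ s ∈ Finset.Icc lo hi, f s = f t := by
    rintro f lo hi t rfl rfl; simp
  have two : ∀ (f : ℤ → K) (lo hi t : ℤ), lo = t → hi = t + 1 →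
      ∑ s ∈ Finset.Icc lo hi, f s = f t + f (t + 1) := by
    rintro f lo hi t rfl rfl
    have : Finset.Icc lo (lo + 1) = {lo, lo + 1} := by
      ext s; simp only [Finset.mem_Icc, Finset.mem_insert, Finset.mem_singleton]; omega
    rw [this, Finset.sum_pair (by omega)]
  have pow : ∀ (t s d : ℤ), t = s + d → r ^ t = r ^ s * r ^ d := by
    rintro t s d rfl; exact zpow_add₀ hr _ _
  have hu := zpow_ne_zero u hr
  rcases huv with hv | hv <;> rcases huw with hw | hw
  · rcases hvz with hz | hz
    · rw [one _ _ _ u (by omega) (by omega), one _ _ _ u (by omega) (by omega),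
        show z - v - w + u = 0 by omega, pow (v + w) u u (by omega), zpow_neg]
      simp [hu]
    · rw [two _ _ _ u (by omega) (by omega), one _ _ _ u (by omega) (by omega),
        show z - v - w + u = 1 by omega, pow (v + w) u u (by omega), zpow_neg,
        zpow_add_one₀ hr, zpow_one]
      field_simp
  · rw [one _ _ _ (u + 1) (by omega) (by omega), one _ _ _ u (by omega) (by omega),
      show z - v - w + u = 0 by omega, pow (v + w) (u + 1) u (by omega), zpow_neg]
    simp [hu]
  · rw [one _ _ _ (u + 1) (by omega) (by omega), one _ _ _ u (by omega) (by omega),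
      show z - v - w + u = 0 by omega, pow (v + w) (u + 1) u (by omega), zpow_neg]
    simp [hu]
  · have hu' := zpow_ne_zero (u + 1) hr
    rcases hvz with hz | hz
    · rw [one _ _ _ (u + 1) (by omega) (by omega), two _ _ _ u (by omega) (by omega),
        show z - v - w + u = -1 by omega, pow (v + w) (u + 1) (u + 1) (by omega), zpow_neg,
        zpow_neg, zpow_neg, zpow_add_one₀ hr, zpow_one]
      field_simp
      ring
    · rw [one _ _ _ (u + 1) (by omega) (by omega), one _ _ _ (u + 1) (by omega) (by omega),
        show z - v - w + u = 0 by omega, pow (v + w) (u + 1) (u + 1) (by omega), zpow_neg]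
      simp [hu']

end Compare

/-! ### Sums over interlacing alternating sign matrices -/

/-- The finite set of `n × n` alternating sign matrices. -/
noncomputable def asmFinset (n : ℕ) : Finset (Matrix (Fin n) (Fin n) ℤ) :=
  (finite_isASM n).toFinset

@[simp] theorem mem_asmFinset {n : ℕ} {A : Matrix (Fin n) (Fin n) ℤ} :
    A ∈ asmFinset n ↔ IsASM A := by
  simp [asmFinset]

/-- The matrix of mixed differences of `c`. -/
def diffMatrix (n : ℕ) (c : ℕ → ℕ → ℤ) : Matrix (Fin n) (Fin n) ℤ :=
  Matrix.of fun i j => mixedDiff c i j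

theorem diffMatrix_cornerSum {n : ℕ} {A : Matrix (Fin n) (Fin n) ℤ} {c : ℕ → ℕ → ℤ}
    (h : ∀ i ≤ n, ∀ j ≤ n, c i j = cornerSum A i j) : diffMatrix n c = A := by
  ext i j
  rw [← extend_val A, ← mixedDiff_cornerSum]
  have := i.2
  have := j.2
  simp only [diffMatrix, Matrix.of_apply, mixedDiff]
  rw [h _ (by omega) _ (by omega), h _ (by omega) _ (by omega), h _ (by omega) _ (by omega),
    h _ (by omega) _ (by omega)]

theorem IsCorner.isASM_diffMatrix {n : ℕ} {c : ℕ → ℕ → ℤ} (h : IsCorner n c) :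
    IsASM (diffMatrix n c) :=
  h.isASM fun _ _ => rfl

theorem IsCorner.cornerSum_diffMatrix {n : ℕ} {c : ℕ → ℕ → ℤ} (h : IsCorner n c) {i j : ℕ}
    (hi : i ≤ n) (hj : j ≤ n) : cornerSum (diffMatrix n c) i j = c i j :=
  cornerSum_of_mixedDiff h.zero_left h.zero_right (fun _ _ => rfl) hi hj

theorem Interlace.congr {k : ℕ} {a a' b b' : ℕ → ℕ → ℤ} (h : Interlace k a b)
    (ha : ∀ i ≤ k + 1, ∀ j ≤ k + 1, a' i j = a i j) (hb : ∀ i ≤ k, ∀ j ≤ k, b' i j = b i j) :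
    Interlace k a' b' := by
  intro i hi j hj
  rw [ha i (by omega) j (by omega), ha (i + 1) (by omega) (j + 1) (by omega),
    ha (i + 1) (by omega) j (by omega), ha i (by omega) (j + 1) (by omega), hb i hi j hj]
  exact h i hi j hj

/-- The function on `{0, …, m + 1}²` with the boundary values of corner sums of matrices of size
`m + 1` and with prescribed interior values. -/
def fillBoundary {m : ℕ} (g : Fin m × Fin m → ℤ) (i j : ℕ) : ℤ :=
  if i = 0 then 0 else if j = 0 then 0 else if i = m + 1 then j else if j = m + 1 then i else
    if h : i - 1 < m ∧ j - 1 < m then g (⟨i - 1, h.1⟩, ⟨j - 1, h.2⟩) else 0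

theorem fillBoundary_interior {m : ℕ} (g : Fin m × Fin m → ℤ) {i j : ℕ} (hi : i < m)
    (hj : j < m) : fillBoundary g (i + 1) (j + 1) = g (⟨i, hi⟩, ⟨j, hj⟩) := by
  simp [fillBoundary, hi, hj, hi.ne, hj.ne]

section FillBoundary

variable {m : ℕ} (g : Fin m × Fin m → ℤ)

theorem fillBoundary_zero_left (j : ℕ) : fillBoundary g 0 j = 0 := by
  simp [fillBoundary]

theorem fillBoundary_zero_right (i : ℕ) : fillBoundary g i 0 = 0 := by
  simp [fillBoundary]

theorem fillBoundary_last_left (j : ℕ) : fillBoundary g (m + 1) j = j := by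
  simp only [fillBoundary]; split_ifs <;> simp_all

theorem fillBoundary_last_right {i : ℕ} : fillBoundary g i (m + 1) = i := by
  simp only [fillBoundary]; split_ifs <;> simp_all

end FillBoundary

/-- The values at `(i + 1, j + 1)` that are allowed for corner sums interlacing `b` from above. -/
noncomputable def upperRange (b : ℕ → ℕ → ℤ) (i j : ℕ) : Finset ℤ :=
  Finset.Icc (max (b (i + 1) (j + 1) - 1) (max (b (i + 1) j) (b i (j + 1))))
    (min (b i j + 1) (b (i + 1) (j + 1)))

/-- The values at `(i, j)` that are allowed for corner sums interlacing `b` from below. -/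
noncomputable def lowerRange (b : ℕ → ℕ → ℤ) (i j : ℕ) : Finset ℤ :=
  Finset.Icc (max (b i j) (b (i + 1) (j + 1) - 1)) (min (b (i + 1) j) (b i (j + 1)))

theorem interlace_fillBoundary {m : ℕ} {b : ℕ → ℕ → ℤ} (hb : IsCorner m b)
    {g : Fin m × Fin m → ℤ} (hg : ∀ p, g p ∈ upperRange b p.1 p.2) :
    Interlace m (fillBoundary g) b := by
  have h0 := fillBoundary_zero_left g
  have h1 := fillBoundary_zero_right g
  have h2 := fillBoundary_last_left g
  have h3 := @fillBoundary_last_right _ g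
  have h4 : ∀ i < m, ∀ j < m, b (i + 1) j ≤ fillBoundary g (i + 1) (j + 1) ∧
      b i (j + 1) ≤ fillBoundary g (i + 1) (j + 1) ∧
      fillBoundary g (i + 1) (j + 1) ≤ b i j + 1 ∧
      fillBoundary g (i + 1) (j + 1) ≤ b (i + 1) (j + 1) := by
    intro i hi j hj
    rw [fillBoundary_interior g hi hj]
    have := hg (⟨i, hi⟩, ⟨j, hj⟩)
    simp only [upperRange, Finset.mem_Icc] at this
    omega
  intro i hi j hj
  have b1 := hb.zero_left j hj
  have b2 := hb.zero_right i hi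
  have b3 := hb.last_left j hj
  have b4 := hb.last_right i hi
  refine ⟨?_, ?_, ?_, ?_⟩
  · rcases i with _ | i
    · rw [h0, b1]
    · rcases j with _ | j
      · rw [h1, b2]
      · exact (h4 i (by omega) j (by omega)).2.2.2
  · rcases Nat.lt_or_ge i m with hi' | hi'
    · rcases Nat.lt_or_ge j m with hj' | hj'
      · exact (h4 i hi' j hj').2.2.1
      · obtain rfl : j = m := by omega
        rw [h3, b4]; push_cast; omega
    · obtain rfl : i = m := by omega
      rw [h2, b3]; push_cast; omega
  · rcases Nat.lt_or_ge i m with hi' | hi'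
    · rcases j with _ | j
      · rw [h1, b2]
      · exact (h4 i hi' j (by omega)).2.1
    · obtain rfl : i = m := by omega
      rw [h2, b3]
  · rcases Nat.lt_or_ge j m with hj' | hj'
    · rcases i with _ | i
      · rw [h0, b1]
      · exact (h4 i (by omega) j hj').1
    · obtain rfl : j = m := by omega
      rw [h3, b4]

section InterlaceSums

variable {K : Type*} [Field K]

open scoped Classical in
theorem sum_interlace_left {m : ℕ} {B : Matrix (Fin m) (Fin m) ℤ} (hB : IsASM B)
    (G : (Fin m × Fin m → ℤ) → K) :
    ∑ A ∈ asmFinset (m + 1) with Interlace m (cornerSum A) (cornerSum B),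
        G (fun p => cornerSum A (p.1 + 1) (p.2 + 1)) =
      ∑ g ∈ Fintype.piFinset fun p : Fin m × Fin m => upperRange (cornerSum B) p.1 p.2, G g := by
  have hb := hB.isCorner
  have key : ∀ g ∈ Fintype.piFinset fun p : Fin m × Fin m => upperRange (cornerSum B) p.1 p.2,
      Interlace m (fillBoundary g) (cornerSum B) ∧ IsCorner (m + 1) (fillBoundary g) := by
    intro g hg
    have h := interlace_fillBoundary hb (Fintype.mem_piFinset.1 hg)
    exact ⟨h, h.isCorner_left (fun j _ => fillBoundary_zero_left g j)
      (fun j _ => fillBoundary_zero_right g j) (fun j _ => fillBoundary_last_left g j)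
      (fun j _ => fillBoundary_last_right g)⟩
  refine Finset.sum_nbij' (fun A p => cornerSum A (p.1 + 1) (p.2 + 1))
    (fun g => diffMatrix (m + 1) (fillBoundary g)) ?_ ?_ ?_ ?_ ?_
  · intro A hA
    rw [Finset.mem_filter, mem_asmFinset] at hA
    rw [Fintype.mem_piFinset]
    rintro ⟨⟨i, hi⟩, ⟨j, hj⟩⟩
    simp only [upperRange, Finset.mem_Icc]
    have h1 := hA.2 i hi.le j hj.le
    have h2 := hA.2 (i + 1) hi j hj.le
    have h3 := hA.2 i hi.le (j + 1) hj
    have h4 := hA.2 (i + 1) hi (j + 1) hj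
    have h5 := hb.step_right (i + 1) hi j hj
    omega
  · intro g hg
    obtain ⟨h1, h2⟩ := key g hg
    rw [Finset.mem_filter, mem_asmFinset]
    exact ⟨h2.isASM_diffMatrix, h1.congr (fun i hi j hj => h2.cornerSum_diffMatrix hi hj)
      fun _ _ _ _ => rfl⟩
  · intro A hA
    rw [Finset.mem_filter, mem_asmFinset] at hA
    have ha := hA.1.isCorner
    refine diffMatrix_cornerSum fun i hi j hj => ?_
    rcases i with _ | i
    · rw [fillBoundary_zero_left, ha.zero_left j hj]
    rcases j with _ | j
    · rw [fillBoundary_zero_right, ha.zero_right _ hi]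
    rcases Nat.lt_or_ge i m with hi' | hi'
    · rcases Nat.lt_or_ge j m with hj' | hj'
      · rw [fillBoundary_interior _ hi' hj']
      · obtain rfl : j = m := by omega
        rw [fillBoundary_last_right, ha.last_right _ hi]
    · obtain rfl : i = m := by omega
      rw [fillBoundary_last_left, ha.last_left _ hj]
  · intro g hg
    funext p
    rw [(key g hg).2.cornerSum_diffMatrix (by omega) (by omega)]
    exact fillBoundary_interior g p.1.2 p.2.2
  · intro A _
    rfl

/-- A function on a square of side `m`, extended by zero. -/
def extendFun {m : ℕ} (g : Fin m × Fin m → ℤ) (i j : ℕ) : ℤ :=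
  extend (Matrix.of fun a b => g (a, b)) i j

open scoped Classical in
theorem sum_interlace_right {n : ℕ} {B : Matrix (Fin (n + 1)) (Fin (n + 1)) ℤ} (hB : IsASM B)
    (G : (Fin (n + 1) × Fin (n + 1) → ℤ) → K) :
    ∑ C ∈ asmFinset n with Interlace n (cornerSum B) (cornerSum C),
        G (fun p => cornerSum C p.1 p.2) =
      ∑ g ∈ Fintype.piFinset fun p : Fin (n + 1) × Fin (n + 1) =>
        lowerRange (cornerSum B) p.1 p.2, G g := by
  have hb := hB.isCorner
  have val : ∀ (g : Fin (n + 1) × Fin (n + 1) → ℤ) (p : Fin (n + 1) × Fin (n + 1)),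
      extendFun g p.1 p.2 = g p := fun g p => extend_val _ _ _
  have key : ∀ g ∈ Fintype.piFinset fun p : Fin (n + 1) × Fin (n + 1) =>
        lowerRange (cornerSum B) p.1 p.2,
      Interlace n (cornerSum B) (extendFun g) ∧ IsCorner n (extendFun g) := by
    intro g hg
    have h : Interlace n (cornerSum B) (extendFun g) := by
      intro i hi j hj
      have h1 := Fintype.mem_piFinset.1 hg (⟨i, by omega⟩, ⟨j, by omega⟩)
      rw [← val g] at h1
      simp only [lowerRange, Finset.mem_Icc] at h1
      omega
    exact ⟨h, h.isCorner_right hb⟩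
  refine Finset.sum_nbij' (fun C p => cornerSum C p.1 p.2)
    (fun g => diffMatrix n (extendFun g)) ?_ ?_ ?_ ?_ ?_
  · intro C hC
    rw [Finset.mem_filter, mem_asmFinset] at hC
    rw [Fintype.mem_piFinset]
    rintro ⟨⟨i, hi⟩, ⟨j, hj⟩⟩
    simp only [lowerRange, Finset.mem_Icc]
    have h1 := hC.2 i (by omega) j (by omega)
    omega
  · intro g hg
    obtain ⟨h1, h2⟩ := key g hg
    rw [Finset.mem_filter, mem_asmFinset]
    exact ⟨h2.isASM_diffMatrix, h1.congr (fun _ _ _ _ => rfl) fun i hi j hj =>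
      h2.cornerSum_diffMatrix hi hj⟩
  · intro C hC
    refine diffMatrix_cornerSum fun i hi j hj => ?_
    exact val (fun p => cornerSum C p.1 p.2) (⟨i, by omega⟩, ⟨j, by omega⟩)
  · intro g hg
    funext p
    rw [(key g hg).2.cornerSum_diffMatrix (by omega) (by omega), val]
  · intro C _
    rfl

/-! ### The Robbins–Rumsey expansion -/

/-- The monomial `∏_{a,b} x_{ab}^{A_{ab}}`. -/
def monomial {n : ℕ} (x : ℕ → ℕ → K) (A : Matrix (Fin n) (Fin n) ℤ) : K :=
  ∏ i : Fin n, ∏ j : Fin n, x i j ^ A i j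

theorem monomial_mul {n : ℕ} (x x' : ℕ → ℕ → K) (A : Matrix (Fin n) (Fin n) ℤ) :
    monomial (fun i j => x i j * x' i j) A = monomial x A * monomial x' A := by
  simp [monomial, mul_zpow, Finset.prod_mul_distrib]

open scoped Classical in
/-- The sum over all `A` interlacing `B` from above and the sum over all `C` interlacing `B` from
below both factor over the cells of `B`; the quotients of the factors are the binomials. -/
theorem sum_monomial_eq {n : ℕ} {x : ℕ → ℕ → K} (hx : ∀ p q, x p q ≠ 0)
    (hx' : ∀ p q, x p q * x (p + 1) (q + 1) + x p (q + 1) * x (p + 1) q ≠ 0)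
    {B : Matrix (Fin (n + 1)) (Fin (n + 1)) ℤ} (hB : IsASM B) :
    ∑ A ∈ asmFinset (n + 2) with Interlace (n + 1) (cornerSum A) (cornerSum B), monomial x A =
      monomial (fun p q => x p q * x (p + 1) (q + 1) + x p (q + 1) * x (p + 1) q) B *
        ∑ C ∈ asmFinset n with Interlace n (cornerSum B) (cornerSum C),
          (monomial (fun p q => x (p + 1) (q + 1)) C)⁻¹ := by
  set b := cornerSum B
  have hr := crossRatio_ne_zero hx
  have hr1 : ∀ p q, 1 + crossRatio x p q ≠ 0 := by
    intro p q
    have h := mul_ne_zero (hx p (q + 1)) (hx (p + 1) q)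
    rw [crossRatio, one_add_div h, add_comm]
    exact div_ne_zero (hx' p q) h
  -- Products of powers of the cross ratios over the cells of `B`.
  let R (g : Fin (n + 1) × Fin (n + 1) → ℤ) : K := ∏ p, crossRatio x p.1 p.2 ^ g p
  have R_ne : ∀ g, R g ≠ 0 := fun g =>
    Finset.prod_ne_zero_iff.2 fun p _ => zpow_ne_zero _ (hr _ _)
  have R_add : ∀ g h, R (fun p => g p + h p) = R g * R h := fun g h => by
    simp only [R, zpow_add₀ (hr _ _), Finset.prod_mul_distrib]
  have R_sub : ∀ g h, R (fun p => g p - h p) = R g / R h := fun g h => by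
    simp only [R, zpow_sub₀ (hr _ _), Finset.prod_div_distrib]
  -- Reference corner sums, those of identity matrices.
  let a₀ : ℕ → ℕ → ℤ := fun i j => min (min (i : ℤ) j) (n + 2 : ℕ)
  let c₀ : ℕ → ℕ → ℤ := fun i j => min (min (i : ℤ) j) n
  have ha₀ : CornerBoundary (n + 2) a₀ := cornerBoundary_min (n + 2)
  have hc₀ : CornerBoundary n c₀ := cornerBoundary_min n
  let U := cornerMonomial (n + 2) x a₀
  let V := cornerMonomial (n + 2) x fun i j => c₀ (i - 1) (j - 1)
  have hV : V ≠ 0 := cornerMonomial_ne_zero hx _ _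
  let P := R fun p => a₀ (p.1 + 1) (p.2 + 1)
  let S := R fun p => c₀ p.1 p.2
  let Φ := monomial (fun p q => x p (q + 1) * x (p + 1) q) B
  have hUV : U * V = Φ * (P * S /
      R fun p => b (p.1 + 1) p.2 + b p.1 (p.2 + 1)) := by
    have h := cornerMonomial_mul hx ha₀ hB.cornerBoundary hc₀
    rw [cornerMonomial_shift_left, cornerMonomial_shift_right] at h
    simp only [U, V, Φ, P, S]
    rw [monomial_mul, ← R_add, ← R_sub]
    exact h
  have left : ∑ A ∈ asmFinset (n + 2) with Interlace (n + 1) (cornerSum A) b, monomial x A =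
      U / P * ∏ p : Fin (n + 1) × Fin (n + 1), ∑ t ∈ upperRange b p.1 p.2,
        crossRatio x p.1 p.2 ^ t := by
    rw [Finset.prod_univ_sum, ← sum_interlace_left hB R, Finset.mul_sum]
    refine Finset.sum_congr rfl fun A hA => ?_
    rw [Finset.mem_filter, mem_asmFinset] at hA
    have h := cornerMonomial_eq_left hx hA.1.cornerBoundary ha₀
    rw [cornerMonomial_cornerSum] at h
    have h' := R_sub (fun p => cornerSum A (p.1 + 1) (p.2 + 1)) fun p => a₀ (p.1 + 1) (p.2 + 1)
    rw [monomial, h, div_mul_eq_mul_div, mul_div_assoc]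
    exact congrArg _ h'
  have right : ∑ C ∈ asmFinset n with Interlace n b (cornerSum C),
        (monomial (fun p q => x (p + 1) (q + 1)) C)⁻¹ =
      S / V * ∏ p : Fin (n + 1) × Fin (n + 1), ∑ t ∈ lowerRange b p.1 p.2,
        crossRatio x p.1 p.2 ^ (-t) := by
    rw [Finset.prod_univ_sum,
      ← sum_interlace_right hB fun g => ∏ p, crossRatio x p.1 p.2 ^ (-g p), Finset.mul_sum]
    refine Finset.sum_congr rfl fun C hC => ?_
    rw [Finset.mem_filter, mem_asmFinset] at hC
    have h := cornerMonomial_eq_right hx hC.1.cornerBoundary hc₀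
    rw [cornerMonomial_shift_both] at h
    have h' := R_sub (fun p => cornerSum C p.1 p.2) fun p => c₀ p.1 p.2
    rw [monomial, h]
    simp only [zpow_neg, Finset.prod_inv_distrib]
    change (V * R _)⁻¹ = S / V * (R fun p => cornerSum C p.1 p.2)⁻¹
    rw [h', mul_inv, inv_div, div_eq_mul_inv, div_eq_mul_inv]
    ring
  have cells : ∏ p : Fin (n + 1) × Fin (n + 1), ∑ t ∈ upperRange b p.1 p.2,
        crossRatio x p.1 p.2 ^ t =
      monomial (fun p q => 1 + crossRatio x p q) B *
        (R fun p => b (p.1 + 1) p.2 + b p.1 (p.2 + 1)) *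
        ∏ p : Fin (n + 1) × Fin (n + 1), ∑ t ∈ lowerRange b p.1 p.2,
          crossRatio x p.1 p.2 ^ (-t) := by
    have hm : monomial (fun p q => 1 + crossRatio x p q) B =
        ∏ p : Fin (n + 1) × Fin (n + 1), (1 + crossRatio x p.1 p.2) ^ mixedDiff b p.1 p.2 := by
      rw [Fintype.prod_prod_type]
      simp only [b, mixedDiff_cornerSum, extend_val, monomial]
    rw [hm]
    simp only [R, ← Finset.prod_mul_distrib]
    refine Finset.prod_congr rfl fun p _ => ?_
    have hb := hB.isCorner
    have h1 := p.1.2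
    have h2 := p.2.2
    exact cell_sum (hr _ _) (hr1 _ _) (hb.step_left _ h1 _ h2.le) (hb.step_right _ h1.le _ h2)
      (hb.step_right _ h1 _ h2) (hb.step_left _ h1 _ h2)
  have hprod : monomial (fun p q => x p q * x (p + 1) (q + 1) + x p (q + 1) * x (p + 1) q) B =
      Φ * monomial (fun p q => 1 + crossRatio x p q) B := by
    rw [← monomial_mul]
    congr 1
    funext p q
    have h1 := hx p (q + 1)
    have h2 := hx (p + 1) q
    rw [crossRatio]
    field_simp
    ring
  have hP : P ≠ 0 := R_ne _
  have hRb := R_ne fun p => b (p.1 + 1) p.2 + b p.1 (p.2 + 1)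
  have hU : U = Φ * (P * S / R fun p => b (p.1 + 1) p.2 + b p.1 (p.2 + 1)) / V := by
    rw [← hUV, mul_div_cancel_right₀ _ hV]
  rw [left, right, cells, hprod, hU]
  field_simp

open scoped Classical in
/-- The value at `(0, 0)` of a nowhere vanishing solution of the octahedron recurrence is a sum
over interlacing pairs of alternating sign matrices, in terms of the first two levels. The
induction replaces the levels `0, 1` by the levels `1, 2`. -/
theorem octahedron_expansion (k : ℕ) {f : ℕ → ℤ → ℤ → K} (hf : ∀ m i j, f m i j ≠ 0)
    (hrec : ∀ m i j, f (m + 2) i j * f m i j =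
      f (m + 1) (i - 1) j * f (m + 1) (i + 1) j + f (m + 1) i (j + 1) * f (m + 1) i (j - 1)) :
    f (k + 1) 0 0 = ∑ B ∈ asmFinset k,
      ∑ A ∈ asmFinset (k + 1) with Interlace k (cornerSum A) (cornerSum B),
        monomial (fun a b => f 1 (-(k : ℤ) + a + b) (b - a)) A *
          (monomial (fun a b => f 0 (-((k : ℤ) - 1) + a + b) (b - a)) B)⁻¹ := by
  induction k generalizing f with
  | zero =>
    have h0 : asmFinset 0 = {1} := by
      ext A
      simp only [mem_asmFinset, Finset.mem_singleton]
      exact ⟨fun _ => Subsingleton.elim _ _, fun _ => by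
        refine ⟨?_, ?_, ?_, ?_, ?_⟩ <;> intro i <;> exact i.elim0⟩
    have h1 : ({A ∈ asmFinset (0 + 1) | Interlace 0 (cornerSum A)
        (cornerSum (1 : Matrix (Fin 0) (Fin 0) ℤ))} : Finset _) = {1} := by
      ext A
      simp only [Finset.mem_filter, mem_asmFinset, Finset.mem_singleton]
      constructor
      · rintro ⟨hA, -⟩
        ext i j
        have := hA.2.2.2.1 0
        rw [Fin.eq_zero i, Fin.eq_zero j]
        simpa using this
      · rintro rfl
        refine ⟨⟨?_, ?_, ?_, ?_, ?_⟩, ?_⟩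
        · intro i j; rw [Fin.eq_zero i, Fin.eq_zero j]; simp
        · intro i j j' h; omega
        · intro i j j' h; omega
        · intro i; rw [Fin.eq_zero i]; simp
        · intro i; rw [Fin.eq_zero i]; simp
        · intro i hi j hj
          obtain rfl : i = 0 := by omega
          obtain rfl : j = 0 := by omega
          simp [cornerSum, extend]
    rw [h0, Finset.sum_singleton, h1, Finset.sum_singleton]
    simp [monomial]
  | succ k ih =>
    have h := ih (f := fun m => f (m + 1)) (fun m => hf _) fun m => hrec _
    rw [h]
    simp only [Finset.sum_filter]
    rw [Finset.sum_comm]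
    refine Finset.sum_congr rfl fun B hB => ?_
    rw [mem_asmFinset] at hB
    simp only [← Finset.sum_filter]
    rw [← Finset.mul_sum, ← Finset.sum_mul]
    have hbin : ∀ p q : ℕ,
        f 1 (-((k + 1 : ℕ) : ℤ) + p + q) (q - p) *
            f 1 (-((k + 1 : ℕ) : ℤ) + (p + 1 : ℕ) + (q + 1 : ℕ)) ((q + 1 : ℕ) - (p + 1 : ℕ)) +
          f 1 (-((k + 1 : ℕ) : ℤ) + p + (q + 1 : ℕ)) ((q + 1 : ℕ) - p) *
            f 1 (-((k + 1 : ℕ) : ℤ) + (p + 1 : ℕ) + q) (q - (p + 1 : ℕ)) =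
        f 2 (-(k : ℤ) + p + q) (q - p) *
          f 0 (-(((k + 1 : ℕ) : ℤ) - 1) + p + q) (q - p) := by
      intro p q
      have h := hrec 0 (-(k : ℤ) + p + q) (q - p)
      push_cast
      rw [show -((k : ℤ) + 1 - 1) + p + q = -(k : ℤ) + p + q by ring, h]
      congr 3 <;> ring
    have hk := sum_monomial_eq (x := fun a b => f 1 (-((k + 1 : ℕ) : ℤ) + a + b) (b - a))
      (fun _ _ => hf _ _ _) (fun p q => by
        rw [hbin]; exact mul_ne_zero (hf _ _ _) (hf _ _ _)) hB
    simp only [hbin] at hk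
    rw [hk, monomial_mul]
    have h0 : monomial (fun a b => f 0 (-(((k + 1 : ℕ) : ℤ) - 1) + a + b) (b - a)) B ≠ 0 :=
      Finset.prod_ne_zero_iff.2 fun _ _ => Finset.prod_ne_zero_iff.2 fun _ _ =>
        zpow_ne_zero _ (hf _ _ _)
    rw [mul_right_comm, mul_inv_cancel_right₀ h0]
    congr 1
    refine Finset.sum_congr rfl fun C _ => ?_
    congr 3
    funext p q
    push_cast
    congr 1 <;> ring

end InterlaceSums

/-! ### Order ideals and corner sums -/

/-- The element of `Q_k` over the node `(i, j)`, parametrized by the corner sum `c`: an ideal that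
has it as its highest element over `(i, j)` has the corner sum `c` there. -/
def node (k : ℕ) (i j : ℕ) (c : ℤ) : ℤ × ℤ × ℤ :=
  (-(k : ℤ) + i + j, -(i : ℤ) + j, 2 * (i + j) - 4 * c - k - 2)

theorem node_inj {k i j i' j' : ℕ} {c c' : ℤ} (h : node k i j c = node k i' j' c') :
    i = i' ∧ j = j' ∧ c = c' := by
  simp only [node, Prod.mk.injEq] at h
  omega

theorem node_mem_Q {k i j : ℕ} {c : ℤ} :
    node k i j c ∈ Q k ↔ 0 ≤ c ∧ (i : ℤ) + j - k ≤ c ∧ c < i ∧ c < j := by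
  simp only [node, Q, Set.mem_ofPred_eq, Int.ModEq]
  rcases abs_cases (-(i : ℤ) + j) with ⟨h, h'⟩ | ⟨h, h'⟩ <;>
    rcases abs_cases (-(k : ℤ) + i + j) with ⟨h1, h1'⟩ | ⟨h1, h1'⟩ <;> rw [h, h1] <;> omega

theorem exists_node {k : ℕ} {x : ℤ × ℤ × ℤ} (hx : x ∈ Q k) : ∃ i j c, x = node k i j c := by
  obtain ⟨r, s, t⟩ := x
  simp only [Q, Set.mem_ofPred_eq, Int.ModEq] at hx
  refine ⟨((k + r - s) / 2).toNat, ((k + r + s) / 2).toNat, (2 * r + k - 2 - t) / 4, ?_⟩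
  simp only [node, Prod.mk.injEq]
  rcases abs_cases s with ⟨h, h'⟩ | ⟨h, h'⟩ <;>
    rcases abs_cases r with ⟨h1, h1'⟩ | ⟨h1, h1'⟩ <;> rw [h, h1] at hx <;> omega

theorem Q_disjoint {k : ℕ} {x : ℤ × ℤ × ℤ} (h : x ∈ Q k) (h' : x ∈ Q (k + 1)) : False := by
  obtain ⟨i, j, c, rfl⟩ := exists_node h
  obtain ⟨i', j', c', he⟩ := exists_node h'
  simp only [node, Prod.mk.injEq] at he
  push_cast at he
  omega

theorem abs_add_abs_eq_one {a b : ℤ} :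
    |a| + |b| = 1 ↔ a = 1 ∧ b = 0 ∨ a = -1 ∧ b = 0 ∨ a = 0 ∧ b = 1 ∨ a = 0 ∧ b = -1 := by
  rcases abs_cases a with ⟨h, h'⟩ | ⟨h, h'⟩ <;>
    rcases abs_cases b with ⟨h1, h1'⟩ | ⟨h1, h1'⟩ <;> rw [h, h1] <;> omega

/-- The elements of `P_k` covered by an element of `Q_k`. -/
theorem coverP_node_iff {k i j : ℕ} {c : ℤ} (h : node k i j c ∈ Q k) {x : ℤ × ℤ × ℤ} :
    CoverP k x (node k i j c) ↔ x ∈ Q (k + 1) ∧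
      (x = node (k + 1) i j c ∨ x = node (k + 1) (i + 1) (j + 1) (c + 1)) := by
  constructor
  · rintro ⟨hx, -, ht, hd⟩
    rw [abs_add_abs_eq_one] at hd
    rcases hx with hx | hx
    · refine ⟨hx, ?_⟩
      obtain ⟨i', j', c', rfl⟩ := exists_node hx
      simp only [node, Prod.mk.injEq] at *
      push_cast at *
      omega
    · obtain ⟨i', j', c', rfl⟩ := exists_node hx
      simp only [node] at *
      omega
  · rintro ⟨hx, hx'⟩
    refine ⟨Or.inl hx, Or.inr h, ?_, ?_⟩
    · rcases hx' with rfl | rfl <;> simp only [node] <;> push_cast <;> ring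
    · rw [abs_add_abs_eq_one]
      rcases hx' with rfl | rfl <;> simp only [node] <;> push_cast <;> omega

/-- The elements of `P_k` covered by an element of `Q_{k+1}`. -/
theorem coverP_node_succ_iff {k i j : ℕ} {c : ℤ} (h : node (k + 1) i j c ∈ Q (k + 1))
    {x : ℤ × ℤ × ℤ} :
    CoverP k x (node (k + 1) i j c) ↔ x ∈ Q k ∧
      (x = node k (i - 1) j c ∨ x = node k i (j - 1) c) := by
  have hm := node_mem_Q.1 h
  constructor
  · rintro ⟨hx, -, ht, hd⟩
    rw [abs_add_abs_eq_one] at hd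
    rcases hx with hx | hx
    · obtain ⟨i', j', c', rfl⟩ := exists_node hx
      simp only [node] at *
      push_cast at *
      omega
    · refine ⟨hx, ?_⟩
      obtain ⟨i', j', c', rfl⟩ := exists_node hx
      simp only [node, Prod.mk.injEq] at *
      push_cast at *
      omega
  · rintro ⟨hx, hx'⟩
    refine ⟨Or.inr hx, Or.inl h, ?_, ?_⟩
    · rcases hx' with rfl | rfl <;> simp only [node] <;> push_cast <;> omega
    · rw [abs_add_abs_eq_one]
      rcases hx' with rfl | rfl <;> simp only [node] <;> push_cast <;> omega

/-- The corner sums `c` encoded by a subset `I` of `Q_k` through its height function: `c i j` is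
the least parameter of an element of `I` over `(i, j)`, and `min i j` if there is none. -/
theorem exists_cornerFun {k : ℕ} {I : Set (ℤ × ℤ × ℤ)} (hI : I ⊆ Q k) :
    ∃ c : ℕ → ℕ → ℤ, (∀ i j : ℕ,
      height k I (-(k : ℤ) + i + j) (-(i : ℤ) + j) = 2 * (i + j) - 4 * c i j) ∧
      (∀ i j, node k i j (c i j) ∈ I ∨ c i j = min (i : ℤ) j) ∧
      ∀ i j d, node k i j d ∈ I → c i j ≤ d := by
  suffices h : ∀ i j : ℕ, ∃ c : ℤ,
      height k I (-(k : ℤ) + i + j) (-(i : ℤ) + j) = 2 * (i + j) - 4 * c ∧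
      (node k i j c ∈ I ∨ c = min (i : ℤ) j) ∧ ∀ d, node k i j d ∈ I → c ≤ d by
    choose c hc using h
    exact ⟨c, fun i j => (hc i j).1, fun i j => (hc i j).2.1, fun i j => (hc i j).2.2⟩
  intro i j
  have hform : ∀ t, (-(k : ℤ) + i + j, -(i : ℤ) + j, t) ∈ I →
      ∃ c, t = 2 * (i + j) - 4 * c - k - 2 := by
    intro t ht
    obtain ⟨i', j', c', he⟩ := exists_node (hI ht)
    simp only [node, Prod.mk.injEq] at he
    exact ⟨c', by omega⟩
  by_cases h : ∃ t, (-(k : ℤ) + i + j, -(i : ℤ) + j, t) ∈ I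
  · have hbdd : BddAbove {t | (-(k : ℤ) + i + j, -(i : ℤ) + j, t) ∈ I} := by
      refine ⟨2 * (i + j) - k - 2, fun t ht => ?_⟩
      obtain ⟨c, rfl⟩ := hform t ht
      have := (node_mem_Q.1 (hI ht)).1
      omega
    have hmem := Int.csSup_mem (s := {t | (-(k : ℤ) + i + j, -(i : ℤ) + j, t) ∈ I}) h hbdd
    obtain ⟨c, hc⟩ := hform _ hmem
    refine ⟨c, ?_, Or.inl ?_, ?_⟩
    · rw [height, if_pos h, hc]; ring
    · rw [hc] at hmem; exact hmem
    · intro d hd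
      have := le_csSup hbdd hd
      rw [hc] at this
      omega
  · refine ⟨min (i : ℤ) j, ?_, Or.inr rfl, fun d hd => absurd ⟨_, hd⟩ h⟩
    rw [height, if_neg h]
    rcases abs_cases (-(i : ℤ) + j) with ⟨h, h'⟩ | ⟨h, h'⟩ <;> rw [h] <;> omega

theorem corresponds_iff {k : ℕ} {I : Set (ℤ × ℤ × ℤ)} {c : ℕ → ℕ → ℤ}
    (hc : ∀ i ≤ k, ∀ j ≤ k,
      height k I (-(k : ℤ) + i + j) (-(i : ℤ) + j) = 2 * (i + j) - 4 * c i j)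
    (A : Matrix (Fin k) (Fin k) ℤ) :
    Corresponds I A ↔ ∀ i j : Fin k, A i j = mixedDiff c i j := by
  have h : ∀ i ≤ k, ∀ j ≤ k, aStar k I i j = (i : ℚ) + j - 2 * c i j := by
    intro i hi j hj
    rw [aStar, hc i hi j hj]
    push_cast
    ring
  refine forall_congr' fun i => forall_congr' fun j => ?_
  have hi := i.2
  have hj := j.2
  rw [h _ (by omega) _ (by omega), h _ (by omega) _ (by omega), h _ (by omega) _ (by omega),
    h _ (by omega) _ (by omega), mixedDiff, ← @Int.cast_inj ℚ]
  push_cast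
  ring_nf

/-- The subset of `Q_k` encoded by corner sums `b`. -/
def idealOf (k : ℕ) (b : ℕ → ℕ → ℤ) : Set (ℤ × ℤ × ℤ) :=
  {x | x ∈ Q k ∧ ∃ i j c, x = node k i j c ∧ b i j ≤ c}

theorem node_mem_idealOf {k : ℕ} {b : ℕ → ℕ → ℤ} {i j : ℕ} {c : ℤ} :
    node k i j c ∈ idealOf k b ↔ node k i j c ∈ Q k ∧ b i j ≤ c := by
  constructor
  · rintro ⟨h, i', j', c', he, hb⟩
    obtain ⟨rfl, rfl, rfl⟩ := node_inj he
    exact ⟨h, hb⟩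
  · rintro ⟨h, hb⟩
    exact ⟨h, i, j, c, rfl, hb⟩

section

variable {k : ℕ} {b : ℕ → ℕ → ℤ}

theorem IsCorner.bounds (hb : IsCorner k b) {i j : ℕ} (hi : i ≤ k) (hj : j ≤ k) :
    0 ≤ b i j ∧ (i : ℤ) + j - k ≤ b i j ∧ b i j ≤ i ∧ b i j ≤ j := by
  have h1 : ∀ i ≤ k, 0 ≤ b i j ∧ b i j ≤ i := by
    intro i
    induction i with
    | zero => intro _; simp [hb.zero_left j hj]
    | succ i ih =>
      intro hi
      have := ih (by omega)
      have := hb.step_left i (by omega) j hj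
      push_cast
      omega
  have h2 : ∀ j ≤ k, b i j ≤ j := by
    intro j
    induction j with
    | zero => intro _; simp [hb.zero_right i hi]
    | succ j ih =>
      intro hj
      have := ih (by omega)
      have := hb.step_right i hi j (by omega)
      push_cast
      omega
  have h3 : ∀ d : ℕ, d ≤ k → (k : ℤ) - d + j - k ≤ b (k - d) j := by
    intro d
    induction d with
    | zero => intro _; rw [Nat.sub_zero, hb.last_left j hj]; simp
    | succ d ih =>
      intro hd
      have h := ih (by omega)
      have h' := hb.step_left (k - (d + 1)) (by omega) j hj
      rw [show k - (d + 1) + 1 = k - d by omega] at h'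
      push_cast
      omega
  have h4 := h3 (k - i) (by omega)
  rw [show k - (k - i) = i by omega] at h4
  have := h1 i hi
  have := h2 j hj
  omega

theorem height_idealOf (hb : IsCorner k b) {i j : ℕ} (hi : i ≤ k) (hj : j ≤ k) :
    height k (idealOf k b) (-(k : ℤ) + i + j) (-(i : ℤ) + j) = 2 * (i + j) - 4 * b i j := by
  obtain ⟨c, h1, h2, h3⟩ := exists_cornerFun (k := k) (I := idealOf k b) fun _ hx => hx.1
  rw [h1]
  have hm := hb.bounds hi hj
  have h4 : b i j < i → b i j < j → c i j ≤ b i j := fun h h' =>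
    h3 i j _ (node_mem_idealOf.2 ⟨node_mem_Q.2 ⟨hm.1, hm.2.1, h, h'⟩, le_rfl⟩)
  have h5 : b i j = c i j := by
    rcases h2 i j with h | h
    · obtain ⟨h, h'⟩ := node_mem_idealOf.1 h
      have := node_mem_Q.1 h
      have := h4 (by omega) (by omega)
      omega
    · omega
  rw [h5]

/-- The order of `P_k`, restricted to `Q_k`, is generated by pairs of successive covers through
`Q_{k+1}`. -/
theorem isIdealQ_idealOf (hb : IsCorner k b) : IsIdealQ k (idealOf k b) := by
  refine ⟨fun _ hx => hx.1, fun x hx y hy hle => ?_⟩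
  have key : y ∈ idealOf k b ∨ ∃ z ∈ idealOf k b, CoverP k y z := by
    clear hy
    induction hle using Relation.ReflTransGen.head_induction_on with
    | refl => exact Or.inl hx
    | head hc _ ih =>
      rcases ih with ih | ⟨z, hz, hyz⟩
      · exact Or.inr ⟨_, ih, hc⟩
      · left
        obtain ⟨hzQ, i, j, c, rfl, hbc⟩ := hz
        have hz := node_mem_Q.1 hzQ
        obtain ⟨hyQ, hy⟩ := (coverP_node_iff hzQ).1 hyz
        have hi : i < k := by omega
        have hj : j < k := by omega
        rcases hy with rfl | rfl
        · obtain ⟨hQ, rfl | rfl⟩ := (coverP_node_succ_iff hyQ).1 hc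
          · have h := hb.step_left (i - 1) (by omega) j hj.le
            rw [show i - 1 + 1 = i by omega] at h
            exact node_mem_idealOf.2 ⟨hQ, by omega⟩
          · have h := hb.step_right i hi.le (j - 1) (by omega)
            rw [show j - 1 + 1 = j by omega] at h
            exact node_mem_idealOf.2 ⟨hQ, by omega⟩
        · obtain ⟨hQ, h' | h'⟩ := (coverP_node_succ_iff hyQ).1 hc <;>
            rw [Nat.add_sub_cancel] at h' <;> subst h'
          · have h := hb.step_right i hi.le j hj
            exact node_mem_idealOf.2 ⟨hQ, by omega⟩
          · have h := hb.step_left i hi j hj.le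
            exact node_mem_idealOf.2 ⟨hQ, by omega⟩
  rcases key with h | ⟨z, ⟨hzQ, i, j, c, rfl, -⟩, hyz⟩
  · exact h
  · exact (Q_disjoint hy ((coverP_node_iff hzQ).1 hyz).1).elim

theorem isIdealP_idealOf {a : ℕ → ℕ → ℤ} (h : Interlace k a b) :
    IsIdealP k (idealOf (k + 1) a ∪ idealOf k b) := by
  refine ⟨Set.union_subset_union (fun _ hx => hx.1) fun _ hx => hx.1, fun x hx y hy hle => ?_⟩
  clear hy
  induction hle using Relation.ReflTransGen.head_induction_on with
  | refl => exact hx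
  | head hc _ ih =>
    rcases ih with ⟨hQ, i, j, c, rfl, hac⟩ | ⟨hQ, i, j, c, rfl, hbc⟩
    · right
      have hm := node_mem_Q.1 hQ
      push_cast at hm
      obtain ⟨hQ', rfl | rfl⟩ := (coverP_node_succ_iff hQ).1 hc
      · have h' := h (i - 1) (by omega) j (by omega)
        rw [show i - 1 + 1 = i by omega] at h'
        exact node_mem_idealOf.2 ⟨hQ', by omega⟩
      · have h' := h i (by omega) (j - 1) (by omega)
        rw [show j - 1 + 1 = j by omega] at h'
        exact node_mem_idealOf.2 ⟨hQ', by omega⟩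
    · left
      have hm := node_mem_Q.1 hQ
      have h' := h i (by omega) j (by omega)
      obtain ⟨hQ', rfl | rfl⟩ := (coverP_node_iff hQ).1 hc
      · exact node_mem_idealOf.2 ⟨hQ', by omega⟩
      · exact node_mem_idealOf.2 ⟨hQ', by omega⟩

end

theorem cornerFun_le {k : ℕ} {I : Set (ℤ × ℤ × ℤ)} (hI : I ⊆ Q k) {i j : ℕ} {c : ℤ}
    (h : node k i j c ∈ I ∨ c = min (i : ℤ) j) : c ≤ i ∧ c ≤ j := by
  rcases h with h | h
  · have := node_mem_Q.1 (hI h)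
    omega
  · omega

theorem cornerSum_eq_of_corresponds {k : ℕ} {I : Set (ℤ × ℤ × ℤ)} (hI : I ⊆ Q k)
    {A : Matrix (Fin k) (Fin k) ℤ} (hA : Corresponds I A) {c : ℕ → ℕ → ℤ}
    (h1 : ∀ i j : ℕ, height k I (-(k : ℤ) + i + j) (-(i : ℤ) + j) = 2 * (i + j) - 4 * c i j)
    (h2 : ∀ i j, node k i j (c i j) ∈ I ∨ c i j = min (i : ℤ) j) {i j : ℕ} (hi : i ≤ k)
    (hj : j ≤ k) : cornerSum A i j = c i j := by
  refine cornerSum_of_mixedDiff ?_ ?_ ((corresponds_iff (fun i _ j _ => h1 i j) A).1 hA) hi hj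
  · intro j _
    rcases h2 0 j with h | h
    · have := node_mem_Q.1 (hI h)
      omega
    · omega
  · intro i _
    rcases h2 i 0 with h | h
    · have := node_mem_Q.1 (hI h)
      omega
    · omega

/-- Compatibility, defined through order ideals of `P_k`, is the interlacing of corner sums. -/
theorem compatible_iff_interlace {k : ℕ} {A : Matrix (Fin (k + 1)) (Fin (k + 1)) ℤ}
    {B : Matrix (Fin k) (Fin k) ℤ} (hA : IsASM A) (hB : IsASM B) :
    Compatible A B ↔ Interlace k (cornerSum A) (cornerSum B) := by
  constructor
  · rintro ⟨I, J, ⟨hI, -⟩, ⟨hJ, -⟩, hIA, hJB, -, hP⟩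
    obtain ⟨a, a1, a2, a3⟩ := exists_cornerFun hI
    obtain ⟨b, b1, b2, b3⟩ := exists_cornerFun hJ
    have down : ∀ x ∈ I ∪ J, ∀ y, CoverP k y x → y ∈ I ∪ J := fun x hx y hxy =>
      hP x hx y hxy.1 (Relation.ReflTransGen.single hxy)
    have downI : ∀ i j c, node (k + 1) i j c ∈ I → ∀ y, CoverP k y (node (k + 1) i j c) →
        y ∈ J := fun i j c h y hy =>
      (down _ (Or.inl h) y hy).resolve_left fun h' =>
        Q_disjoint ((coverP_node_succ_iff (hI h)).1 hy).1 (hI h')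
    have downJ : ∀ i j c, node k i j c ∈ J → ∀ y, CoverP k y (node k i j c) →
        y ∈ I := fun i j c h y hy =>
      (down _ (Or.inr h) y hy).resolve_right fun h' =>
        Q_disjoint (hJ h') ((coverP_node_iff (hJ h)).1 hy).1
    have key : Interlace k a b := by
      intro i _ j _
      have a00 := cornerFun_le hI (a2 i j)
      have a11 := cornerFun_le hI (a2 (i + 1) (j + 1))
      have b00 := cornerFun_le hJ (b2 i j)
      push_cast at a11
      refine ⟨?_, ?_, ?_, ?_⟩
      · rcases b2 i j with h | h
        · have hm := node_mem_Q.1 (hJ h)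
          have hQ : node (k + 1) i j (b i j) ∈ Q (k + 1) :=
            node_mem_Q.2 (by push_cast; omega)
          exact a3 i j _ (downJ i j _ h _ ((coverP_node_iff (hJ h)).2 ⟨hQ, Or.inl rfl⟩))
        · omega
      · rcases b2 i j with h | h
        · have hm := node_mem_Q.1 (hJ h)
          have hQ : node (k + 1) (i + 1) (j + 1) (b i j + 1) ∈ Q (k + 1) :=
            node_mem_Q.2 (by push_cast; omega)
          exact a3 _ _ _ (downJ i j _ h _ ((coverP_node_iff (hJ h)).2 ⟨hQ, Or.inr rfl⟩))
        · omega
      · rcases a2 (i + 1) j with h | h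
        · have hm := node_mem_Q.1 (hI h)
          push_cast at hm
          rcases lt_or_ge (a (i + 1) j) i with hlt | hge
          · have hQ : node k i j (a (i + 1) j) ∈ Q k := node_mem_Q.2 (by omega)
            exact b3 i j _ (downI _ _ _ h _ ((coverP_node_succ_iff (hI h)).2 ⟨hQ, Or.inl rfl⟩))
          · omega
        · push_cast at h; omega
      · rcases a2 i (j + 1) with h | h
        · have hm := node_mem_Q.1 (hI h)
          push_cast at hm
          rcases lt_or_ge (a i (j + 1)) j with hlt | hge
          · have hQ : node k i j (a i (j + 1)) ∈ Q k := node_mem_Q.2 (by omega)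
            exact b3 i j _ (downI _ _ _ h _ ((coverP_node_succ_iff (hI h)).2 ⟨hQ, Or.inr rfl⟩))
          · omega
        · push_cast at h; omega
    exact key.congr (fun i hi j hj => cornerSum_eq_of_corresponds hI hIA a1 a2 hi hj)
      fun i hi j hj => cornerSum_eq_of_corresponds hJ hJB b1 b2 hi hj
  · intro h
    have ha := hA.isCorner
    have hb := hB.isCorner
    refine ⟨idealOf (k + 1) (cornerSum A), idealOf k (cornerSum B), isIdealQ_idealOf ha,
      isIdealQ_idealOf hb, ?_, ?_, isIdealP_idealOf h⟩
    · rw [corresponds_iff fun i hi j hj => height_idealOf ha hi hj]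
      intro i j
      rw [mixedDiff_cornerSum, extend_val]
    · rw [corresponds_iff fun i hi j hj => height_idealOf hb hi hj]
      intro i j
      rw [mixedDiff_cornerSum, extend_val]

/-! ### The expansion of `F_{0,k}` -/

theorem monomial_octa_one {K : Type*} [Field K] (y : ℤ → K) (k : ℕ)
    (A : Matrix (Fin (k + 1)) (Fin (k + 1)) ℤ) :
    monomial (fun a b => octa y 1 (-(k : ℤ) + a + b) (b - a)) A = matPow (X y (k + 1)) A := by
  simp [monomial, matPow, X, octa, mLevel, Faux]

theorem monomial_octa_zero {K : Type*} [Field K] (y : ℤ → K) (k : ℕ)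
    (B : Matrix (Fin k) (Fin k) ℤ) :
    (monomial (fun a b => octa y 0 (-((k : ℤ) - 1) + a + b) (b - a)) B)⁻¹ =
      matPow (X y k) B := by
  simp only [monomial, matPow, X, octa, mLevel, Faux, mul_one, inv_zpow, Finset.prod_inv_distrib,
    inv_inv, Matrix.of_apply]

theorem octa_zero_zero {K : Type*} [Field K] (y : ℤ → K) (k : ℕ) :
    octa y (k + 1) 0 0 = F y 0 k := by
  simp [octa, F, mLevel_zero_right]

end PentagramASM

open PentagramASM in
theorem proposition6p3 (n k : ℕ) :
    PentagramASM.F (PentagramASM.yVar n) 0 k =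
      ∑ p ∈ (PentagramASM.compatiblePairs_finite k).toFinset,
        PentagramASM.matPow (PentagramASM.X (PentagramASM.yVar n) (k + 1)) p.1 *
          PentagramASM.matPow (PentagramASM.X (PentagramASM.yVar n) k) p.2 := by
  classical
  rw [← octa_zero_zero, octahedron_expansion k (octa_ne_zero n)
    (octa_rec (fun j => (posAtOne_yVar n j).ne_zero) fun k j => (posAtOne_Faux n k j).ne_zero),
    Finset.sum_finset_product_right (compatiblePairs_finite k).toFinset (asmFinset k) fun B =>
      {A ∈ asmFinset (k + 1) | Interlace k (cornerSum A) (cornerSum B)}]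
  · refine Finset.sum_congr rfl fun B _ => Finset.sum_congr (by congr!) fun A _ => ?_
    rw [monomial_octa_one, monomial_octa_zero]
  · rintro ⟨A, B⟩
    rw [Set.Finite.mem_toFinset, Finset.mem_filter, mem_asmFinset, mem_asmFinset]
    constructor
    · rintro ⟨hA, hB, h⟩
      exact ⟨hB, hA, (compatible_iff_interlace hA hB).1 h⟩
    · rintro ⟨hB, hA, h⟩
      exact ⟨hA, hB, (compatible_iff_interlace hA hB).2 h⟩
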